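/- Let $G=\mathrm{PSL}(2,\mathbb{R})$ act on the upper half-plane $\mathbb{H}$ by Möbius transformations; call $A\in G$ elliptic if it has a unique fixed point in $\mathbb{H}$. Let $\pi_1(\Sigma_3)=\langle c_1,c_2,c_3 : c_1c_2c_3=1\rangle$ be the fundamental group of the thrice-punctured sphere and $\partial\pi_1(\Sigma_3)=\{\langle c_1\rangle,\langle c_2\rangle,\langle c_3\rangle\}$. Fix one of the two orientations of $\mathbb{H}$. For $z_1,z_2,z_3\in\mathbb{H}$ let $[\Delta(z_1,z_2,z_3)]$ be the signed hyperbolic area of the geodesic triangle $\Delta(z_1,z_2,z_3)$: its area for $dx\,dy/y^2$ with sign $+$ if the ordered triangle is positively oriented and sign $-$ if it is negatively oriented (and $0$ if it is degenerate). For a base point $z\in\mathbb{H}$, let $$c_z\colon G\times G\to\mathbb{R},\qquad c_z(A_1,A_2)=[\Delta(z,A_1z,A_1A_2z)].$$ For a homomorphism $\phi\colon\pi_1(\Sigma_3)\to G$, the volume of $\phi$ is $$\mathrm{vol}(\phi)=\big\langle j^{-1}(\phi^*\kappa),\,[\pi_1(\Sigma_3),\partial\pi_1(\Sigma_3)]\big\rangle,$$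 where $\kappa=[c_z]\in H^2_b(G;\mathbb{R})$, where $j\colon H^2_b(\pi_1(\Sigma_3),\partial\pi_1(\Sigma_3);\mathbb{R})\to H^2_b(\pi_1(\Sigma_3);\mathbb{R})$ is the natural isomorphism in bounded cohomology, and where the fundamental class is represented in the relative bar complex by $(e,c_1,c_2,c_3)$ with $e=(c_1,c_2)+(c_1c_2,c_3)+(1,1)$. Lemma 3.3. Let $\phi\colon\pi_1(\Sigma_3)\to G$ be a homomorphism such that $\phi(c_1),\phi(c_2),\phi(c_3)$ are elliptic, with fixed points $C_1,C_2,C_3\in\mathbb{H}$ respectively. Then, for every base point $z\in\mathbb{H}$, $c_z$ is a bounded $2$-cocycle on $G$, and the volume of $\phi$ computed with $\kappa=[c_z]$ is $$\mathrm{vol}(\phi)=-2\,[\Delta(C_1,C_2,C_3)].$$ -/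

import Mathlib

open scoped MatrixGroups UpperHalfPlane
open MeasureTheory

noncomputable section

namespace PuncturedSphere

/-! ### Bounded cohomology in the bar resolution (trivial real coefficients) -/

section BoundedCohomology

/-- Bounded real functions on a set. -/
def boundedFun (X : Type*) : Submodule ℝ (X → ℝ) where
  carrier := {f | ∃ C : ℝ, ∀ x, |f x| ≤ C}
  zero_mem' := ⟨0, by simp⟩
  add_mem' := by
    rintro f g ⟨C, hC⟩ ⟨D, hD⟩
    exact ⟨C + D, fun x => (abs_add_le _ _).trans (add_le_add (hC x) (hD x))⟩
  smul_mem' := by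
    rintro r f ⟨C, hC⟩
    refine ⟨|r| * C, fun x => ?_⟩
    simp only [Pi.smul_apply, smul_eq_mul, abs_mul]
    exact mul_le_mul_of_nonneg_left (hC x) (abs_nonneg r)

/-- The bar differential from `1`-cochains to `2`-cochains. -/
def delta₁ (Γ : Type*) [Group Γ] : (Γ → ℝ) →ₗ[ℝ] (Γ × Γ → ℝ) where
  toFun h p := h p.2 - h (p.1 * p.2) + h p.1
  map_add' _ _ := by ext; simp only [Pi.add_apply]; ring
  map_smul' _ _ := by ext; simp only [Pi.smul_apply, smul_eq_mul, RingHom.id_apply]; ring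

/-- The bar differential from `2`-cochains to `3`-cochains. -/
def delta₂ (Γ : Type*) [Group Γ] : (Γ × Γ → ℝ) →ₗ[ℝ] (Γ × Γ × Γ → ℝ) where
  toFun f p := f (p.2.1, p.2.2) - f (p.1 * p.2.1, p.2.2) + f (p.1, p.2.1 * p.2.2)
    - f (p.1, p.2.1)
  map_add' _ _ := by ext; simp only [Pi.add_apply]; ring
  map_smul' _ _ := by ext; simp only [Pi.smul_apply, smul_eq_mul, RingHom.id_apply]; ring

variable (Γ : Type*) [Group Γ]

/-- Bounded `2`-cocycles. -/
def boundedCocycles : Submodule ℝ (Γ × Γ → ℝ) :=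
  boundedFun (Γ × Γ) ⊓ LinearMap.ker (delta₂ Γ)

/-- Coboundaries of bounded `1`-cochains. -/
def boundedCoboundaries : Submodule ℝ (Γ × Γ → ℝ) :=
  (boundedFun Γ).map (delta₁ Γ)

/-- The second bounded cohomology `H²_b(Γ; ℝ)`. -/
abbrev BoundedH2 : Type _ :=
  boundedCocycles Γ ⧸ (boundedCoboundaries Γ).submoduleOf (boundedCocycles Γ)

variable {Γ} in
/-- The class in `H²_b(Γ; ℝ)` of a `2`-cochain that is a bounded cocycle (and `0` by convention
for any other `2`-cochain). -/
def boundedClass (f : Γ × Γ → ℝ) : BoundedH2 Γ :=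
  open Classical in
  if h : f ∈ boundedCocycles Γ then Submodule.Quotient.mk ⟨f, h⟩ else 0

variable {Γ} in
/-- Pull-back of `2`-cochains along a group homomorphism. -/
def pullbackCochain {G : Type*} [Group G] (φ : Γ →* G) : (G × G → ℝ) →ₗ[ℝ] (Γ × Γ → ℝ) :=
  LinearMap.funLeft ℝ ℝ (Prod.map φ φ)

variable {Γ} in
lemma pullbackCochain_mem {G : Type*} [Group G] (φ : Γ →* G) :
    ∀ f ∈ boundedCocycles G, pullbackCochain φ f ∈ boundedCocycles Γ := by
  rintro f ⟨⟨C, hC⟩, hf⟩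
  refine ⟨⟨C, fun x => hC _⟩, ?_⟩
  ext ⟨a, b, c⟩
  have := congrFun hf (φ a, φ b, φ c)
  simpa [delta₂, pullbackCochain, LinearMap.funLeft] using this

variable {Γ} in
/-- The map `φ^* : H²_b(G; ℝ) → H²_b(Γ; ℝ)` induced by a group homomorphism `φ : Γ → G`. -/
def BoundedH2.pullback {G : Type*} [Group G] (φ : Γ →* G) : BoundedH2 G →ₗ[ℝ] BoundedH2 Γ :=
  Submodule.mapQ _ _ ((pullbackCochain φ).restrict (pullbackCochain_mem φ)) (by
    rintro ⟨f, hf⟩ ⟨h, ⟨C, hC⟩, hh⟩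
    refine ⟨h ∘ φ, ⟨C, fun x => hC _⟩, ?_⟩
    ext ⟨a, b⟩
    have := congrFun hh (φ a, φ b)
    simpa [delta₁, pullbackCochain, LinearMap.funLeft] using this)

/-! ### Relative bounded cohomology of a group and a finite family of subgroups

The relative cochain complex is the mapping cone of the restriction map: a relative `n`-cochain is
a pair of a bounded `n`-cochain `f` of `Γ` and a family of bounded `(n-1)`-cochains `k i` of the
subgroups `H i`, and the differential is `(f, k) ↦ (δ f, (f|_{H i} - δ (k i))_i)`. -/

variable {ι : Type*} (H : ι → Subgroup Γ)

/-- Restriction of functions on `Γ × Γ` to a subgroup. -/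
def restr₂ {Γ : Type*} [Group Γ] (f : Γ × Γ → ℝ) (K : Subgroup Γ) : K × K → ℝ :=
  fun p => f (p.1, p.2)

/-- Relative bounded `2`-cocycles `(f, k)`: `f` is a bounded cocycle and each `k i` is a bounded
primitive of the restriction of `f` to `H i`. -/
def relBoundedCocycles : Submodule ℝ ((Γ × Γ → ℝ) × (∀ i, H i → ℝ)) where
  carrier := {x | x.1 ∈ boundedCocycles Γ ∧
    ∀ i, x.2 i ∈ boundedFun (H i) ∧ restr₂ x.1 (H i) = delta₁ (H i) (x.2 i)}
  zero_mem' := ⟨zero_mem _, fun i => ⟨zero_mem _, by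
    simp only [Prod.snd_zero, Pi.zero_apply, map_zero]; rfl⟩⟩
  add_mem' := by
    rintro x y ⟨hx, hx'⟩ ⟨hy, hy'⟩
    refine ⟨add_mem hx hy, fun i => ⟨add_mem (hx' i).1 (hy' i).1, ?_⟩⟩
    rw [Prod.snd_add, Pi.add_apply, map_add, ← (hx' i).2, ← (hy' i).2]; rfl
  smul_mem' := by
    rintro r x ⟨hx, hx'⟩
    refine ⟨Submodule.smul_mem _ r hx, fun i => ⟨Submodule.smul_mem _ r (hx' i).1, ?_⟩⟩
    rw [Prod.smul_snd, Pi.smul_apply, map_smul, ← (hx' i).2]; rfl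

/-- The differential of a relative `1`-cochain `(h, t)`. The `t i` are `0`-cochains with trivial
coefficients, that is, real constants; their differentials vanish. -/
def relDelta₁ : (Γ → ℝ) →ₗ[ℝ] ((Γ × Γ → ℝ) × (∀ i, H i → ℝ)) where
  toFun h := (delta₁ Γ h, fun _ x => h x)
  map_add' _ _ := by simp only [map_add]; rfl
  map_smul' _ _ := by simp only [map_smul]; rfl

/-- Relative bounded `2`-coboundaries. -/
def relBoundedCoboundaries : Submodule ℝ ((Γ × Γ → ℝ) × (∀ i, H i → ℝ)) :=
  (boundedFun Γ).map (relDelta₁ Γ H)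

/-- The second relative bounded cohomology `H²_b(Γ, H; ℝ)`. -/
abbrev RelBoundedH2 : Type _ :=
  relBoundedCocycles Γ H ⧸
    (relBoundedCoboundaries Γ H).submoduleOf (relBoundedCocycles Γ H)

/-- The map `j : H²_b(Γ, H; ℝ) → H²_b(Γ; ℝ)`, `[(f, k)] ↦ [f]`, of the long exact sequence. -/
def jMap : RelBoundedH2 Γ H →ₗ[ℝ] BoundedH2 Γ :=
  Submodule.mapQ _ _
    ((LinearMap.fst ℝ (Γ × Γ → ℝ) (∀ i, H i → ℝ)).restrict (p := relBoundedCocycles Γ H)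
      (q := boundedCocycles Γ) fun _ hx => hx.1)
    (by
      rintro ⟨x, hx⟩ ⟨h, hb, hh⟩
      exact ⟨h, hb, congrArg Prod.fst hh⟩)

end BoundedCohomology

section Amenability

open Filter Topology

/-- The average of `F` over the first `N + 1` powers of `g`. -/
def avg {K : Type*} [Group K] (g : K) (F : K → ℝ) (N : ℕ) : ℝ :=
  (∑ n ∈ Finset.range (N + 1), F (g ^ n)) / (N + 1)

lemma abs_avg_le {K : Type*} [Group K] (g : K) {F : K → ℝ} {C : ℝ} (hF : ∀ x, |F x| ≤ C) (N : ℕ) :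
    |avg g F N| ≤ C := by
  have hN : (0 : ℝ) < N + 1 := by positivity
  rw [avg, abs_div, abs_of_pos hN, div_le_iff₀ hN]
  refine (Finset.abs_sum_le_sum_abs _ _).trans ((Finset.sum_le_sum fun i _ => hF _).trans ?_)
  simp [mul_comm]

lemma exists_tendsto_avg {K : Type*} [Group K] (g : K) {F : K → ℝ} (hF : F ∈ boundedFun K) :
    ∃ L, Tendsto (avg g F) (hyperfilter ℕ : Filter ℕ) (𝓝 L) := by
  obtain ⟨C, hC⟩ := hF
  obtain ⟨L, -, hL⟩ := (isCompact_Icc (a := -C) (b := C)).ultrafilter_le_nhds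
    ((hyperfilter ℕ).map (avg g F))
    (le_principal_iff.2 (Filter.mem_map.2 (Filter.univ_mem' fun N => abs_le.1 (abs_avg_le g hC N))))
  exact ⟨L, hL⟩

lemma tendsto_avg_mul {K : Type*} [Group K] (g : K) {F : K → ℝ} (hF : F ∈ boundedFun K) {L : ℝ}
    (hL : Tendsto (avg g F) (hyperfilter ℕ : Filter ℕ) (𝓝 L)) :
    Tendsto (avg g fun x => F (g * x)) (hyperfilter ℕ : Filter ℕ) (𝓝 L) := by
  obtain ⟨C, hC⟩ := hF
  have key : ∀ N, avg g (fun x => F (g * x)) N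
      = avg g F N + (F (g ^ (N + 1)) - F 1) * (1 / ((N : ℝ) + 1)) := by
    intro N
    have h := Finset.sum_range_succ (fun n => F (g ^ n)) (N + 1)
    rw [Finset.sum_range_succ'] at h
    simp only [pow_zero] at h
    simp only [avg, ← pow_succ']
    rw [eq_sub_of_add_eq h]
    ring
  have h0 : Tendsto (fun N : ℕ => (F (g ^ (N + 1)) - F 1) * (1 / ((N : ℝ) + 1)))
      (hyperfilter ℕ : Filter ℕ) (𝓝 0) := by
    refine Tendsto.mono_left ?_ Nat.hyperfilter_le_atTop
    refine squeeze_zero_norm (a := fun N : ℕ => (C + C) * (1 / ((N : ℝ) + 1))) (fun N => ?_) ?_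
    · rw [norm_mul, Real.norm_eq_abs, Real.norm_eq_abs,
        abs_of_pos (a := 1 / ((N : ℝ) + 1)) (by positivity)]
      exact mul_le_mul_of_nonneg_right ((abs_sub _ _).trans (add_le_add (hC _) (hC _)))
        (by positivity)
    · simpa using (tendsto_one_div_add_atTop_nhds_zero_nat (𝕜 := ℝ)).const_mul (C + C)
  have := hL.add h0
  rw [add_zero] at this
  exact this.congr fun N => (key N).symm

lemma boundedFun_comp_mul {K : Type*} [Group K] {F : K → ℝ} (hF : F ∈ boundedFun K) (b : K) :
    (fun x => F (b * x)) ∈ boundedFun K := by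
  obtain ⟨C, hC⟩ := hF
  exact ⟨C, fun x => hC _⟩

/-- Invariance of the limits of averages under translations by powers of `g`. -/
lemma tendsto_avg_translate {K : Type*} [Group K] (g : K) {b : K}
    (hb : b ∈ Subgroup.zpowers g) : ∀ F ∈ boundedFun K, ∀ L,
      Tendsto (avg g F) (hyperfilter ℕ : Filter ℕ) (𝓝 L) →
      Tendsto (avg g fun x => F (b * x)) (hyperfilter ℕ : Filter ℕ) (𝓝 L) := by
  obtain ⟨n, rfl⟩ := Subgroup.mem_zpowers_iff.1 hb
  refine zpow_induction_left (P := fun b => ∀ F ∈ boundedFun K, ∀ L,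
      Tendsto (avg g F) (hyperfilter ℕ : Filter ℕ) (𝓝 L) →
      Tendsto (avg g fun x => F (b * x)) (hyperfilter ℕ : Filter ℕ) (𝓝 L)) ?_ ?_ ?_ n
  · intro F _ L hL
    simpa using hL
  · intro a ih F hF L hL
    simp only [mul_assoc]
    exact ih (fun x => F (g * x)) (boundedFun_comp_mul hF g) L (tendsto_avg_mul g hF hL)
  · intro a ih F hF L hL
    simp only [mul_assoc]
    refine ih (fun x => F (g⁻¹ * x)) (boundedFun_comp_mul hF _) L ?_
    obtain ⟨L', hL'⟩ := exists_tendsto_avg g (boundedFun_comp_mul hF g⁻¹)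
    have h := tendsto_avg_mul g (boundedFun_comp_mul hF g⁻¹) hL'
    simp only [inv_mul_cancel_left] at h
    rwa [tendsto_nhds_unique hL h]

/-- On a cyclic group every bounded `2`-cocycle has a bounded primitive. -/
lemma exists_bounded_primitive {K : Type*} [Group K] [IsCyclic K] {f : K × K → ℝ}
    (hf : f ∈ boundedCocycles K) : ∃ k ∈ boundedFun K, f = delta₁ K k := by
  obtain ⟨g, hg⟩ := IsCyclic.exists_generator (α := K)
  obtain ⟨⟨C, hC⟩, hc⟩ := hf
  have hb : ∀ a, (fun x => f (a, x)) ∈ boundedFun K := fun a => ⟨C, fun x => hC _⟩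
  choose k hk using fun a => exists_tendsto_avg g (hb a)
  refine ⟨k, ⟨C, fun a => ?_⟩, ?_⟩
  · exact le_of_tendsto (hk a).abs (Eventually.of_forall (abs_avg_le g fun x => hC (a, x)))
  · ext ⟨a, b⟩
    have h3 := tendsto_avg_translate g (hg b) _ (hb a) _ (hk a)
    have h := ((hk b).sub (hk (a * b))).add h3
    have hconst : ∀ N, avg g (fun x => f (b, x)) N - avg g (fun x => f (a * b, x)) N
        + avg g (fun x => f (a, b * x)) N = f (a, b) := by
      intro N
      have hN : ((N : ℝ) + 1) ≠ 0 := by positivity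
      simp only [avg]
      rw [← sub_div, ← add_div, ← Finset.sum_sub_distrib, ← Finset.sum_add_distrib,
        div_eq_iff hN, Finset.sum_congr rfl (g := fun _ => f (a, b))]
      · simp [mul_comm]
      · intro n _
        have := congrFun hc (a, b, g ^ n)
        simp only [delta₂, LinearMap.coe_mk, AddHom.coe_mk, Pi.zero_apply] at this
        linarith
    exact tendsto_nhds_unique (tendsto_const_nhds.congr fun N => (hconst N).symm) h

/-- A bounded homomorphism to the reals vanishes. -/
lemma eq_zero_of_bounded_additive {K : Type*} [Group K] {u : K → ℝ} (hu : u ∈ boundedFun K)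
    (h : delta₁ K u = 0) : u = 0 := by
  obtain ⟨C, hC⟩ := hu
  have hadd : ∀ a b, u (a * b) = u a + u b := by
    intro a b
    have := congrFun h (a, b)
    simp only [delta₁, LinearMap.coe_mk, AddHom.coe_mk, Pi.zero_apply] at this
    linarith
  have hpow : ∀ a (n : ℕ), u (a ^ (n + 1)) = (n + 1) * u a := by
    intro a n
    induction n with
    | zero => simp
    | succ n ih => rw [pow_succ, hadd, ih]; push_cast; ring
  ext a
  by_contra hne
  have hpos : 0 < |u a| := abs_pos.2 hne
  obtain ⟨n, hn⟩ := exists_nat_gt (C / |u a|)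
  have h1 := hC (a ^ (n + 1))
  rw [hpow, abs_mul, abs_of_pos (by positivity : (0 : ℝ) < (n : ℝ) + 1)] at h1
  rw [div_lt_iff₀ hpos] at hn
  nlinarith

/-- `j` is an isomorphism when the subgroups are cyclic (hence amenable). -/
lemma jMap_bijective (Γ : Type*) [Group Γ] {ι : Type*} (H : ι → Subgroup Γ)
    [∀ i, IsCyclic (H i)] : Function.Bijective (jMap Γ H) := by
  constructor
  · rw [← LinearMap.ker_eq_bot, LinearMap.ker_eq_bot']
    intro x hx
    obtain ⟨⟨⟨f, k⟩, hf, hk⟩, rfl⟩ := Submodule.Quotient.mk_surjective _ x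
    simp only [jMap, Submodule.mapQ_apply, Submodule.Quotient.mk_eq_zero] at hx
    obtain ⟨h, hb, hh⟩ := hx
    rw [Submodule.Quotient.mk_eq_zero]
    refine ⟨h, hb, Prod.ext hh ?_⟩
    funext i
    have hbi : (fun x : H i => h x) ∈ boundedFun (H i) := by
      obtain ⟨C, hC⟩ := hb
      exact ⟨C, fun x => hC _⟩
    have hd : delta₁ (H i) ((fun x : H i => h x) - k i) = 0 := by
      rw [map_sub, ← (hk i).2, sub_eq_zero]
      ext ⟨a, b⟩
      exact congrFun hh (a, b)
    exact sub_eq_zero.1 (eq_zero_of_bounded_additive (sub_mem hbi (hk i).1) hd)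
  · intro y
    obtain ⟨⟨f, hf⟩, rfl⟩ := Submodule.Quotient.mk_surjective _ y
    have hr : ∀ i, restr₂ f (H i) ∈ boundedCocycles (H i) := fun i =>
      pullbackCochain_mem (H i).subtype f hf
    choose k hk hk' using fun i => exists_bounded_primitive (hr i)
    exact ⟨Submodule.Quotient.mk ⟨(f, k), hf, fun i => ⟨hk i, hk' i⟩⟩, rfl⟩

/-- The isomorphism `j`. -/
def jEquiv (Γ : Type*) [Group Γ] {ι : Type*} (H : ι → Subgroup Γ) [∀ i, IsCyclic (H i)] :
    RelBoundedH2 Γ H ≃ₗ[ℝ] BoundedH2 Γ :=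
  LinearEquiv.ofBijective (jMap Γ H) (jMap_bijective Γ H)

end Amenability

/-! ### Relative cycles and the pairing with relative bounded cohomology -/

section Homology

variable (Γ : Type*) [Group Γ] {ι : Type*} [Fintype ι] (H : ι → Subgroup Γ)

/-- The boundary `(a, b) ↦ b - a b + a` from `2`-chains to `1`-chains of the bar complex. -/
def boundary₂ : (Γ × Γ →₀ ℝ) →ₗ[ℝ] (Γ →₀ ℝ) :=
  Finsupp.lsum ℝ fun p => LinearMap.toSpanSingleton ℝ _
    (Finsupp.single p.2 1 - Finsupp.single (p.1 * p.2) 1 + Finsupp.single p.1 1)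

/-- Relative `2`-cycles: pairs of a `2`-chain `e` of `Γ` and a family of `1`-chains `a i` of the
subgroups `H i` (whose boundaries vanish for trivial coefficients) with `∂ e = ∑ i, a i`. -/
def relCycles : Submodule ℝ ((Γ × Γ →₀ ℝ) × (∀ i, H i →₀ ℝ)) where
  carrier := {x | boundary₂ Γ x.1 = ∑ i, (x.2 i).mapDomain (Subtype.val : H i → Γ)}
  zero_mem' := by simp [Finsupp.mapDomain_zero]
  add_mem' := by
    intro x y hx hy
    simp only [Set.mem_ofPred_eq] at hx hy ⊢
    simp [hx, hy, Finsupp.mapDomain_add, Finset.sum_add_distrib]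
  smul_mem' := by
    intro r x hx
    simp only [Set.mem_ofPred_eq] at hx ⊢
    simp [hx, Finsupp.mapDomain_smul, Finset.smul_sum]

variable {Γ H}

/-- The evaluation `⟨(f, k), (e, a)⟩ = f(e) - ∑ i, k i (a i)` of relative cochains on a relative
chain. -/
def evalChain (E : (Γ × Γ →₀ ℝ) × (∀ i, H i →₀ ℝ)) :
    ((Γ × Γ → ℝ) × (∀ i, H i → ℝ)) →ₗ[ℝ] ℝ where
  toFun x := Finsupp.linearCombination ℝ x.1 E.1
    - ∑ i, Finsupp.linearCombination ℝ (x.2 i) (E.2 i)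
  map_add' x y := by
    simp only [Finsupp.linearCombination_apply, Finsupp.sum, Prod.fst_add, Prod.snd_add,
      Pi.add_apply, smul_add, Finset.sum_add_distrib]
    ring
  map_smul' r x := by
    simp only [Finsupp.linearCombination_apply, Finsupp.sum, Prod.smul_fst, Prod.smul_snd,
      Pi.smul_apply, smul_eq_mul, RingHom.id_apply, mul_sub, Finset.mul_sum]
    congr 1
    · exact Finset.sum_congr rfl fun _ _ => by ring
    · exact Finset.sum_congr rfl fun _ _ => Finset.sum_congr rfl fun _ _ => by ring

lemma linearCombination_delta₁ (h : Γ → ℝ) (e : Γ × Γ →₀ ℝ) :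
    Finsupp.linearCombination ℝ (delta₁ Γ h) e
      = Finsupp.linearCombination ℝ h (boundary₂ Γ e) := by
  induction e using Finsupp.induction_linear with
  | zero => simp
  | add x y hx hy => simp [hx, hy]
  | single p r => simp [boundary₂, delta₁, mul_add, mul_sub]

/-- Evaluation of relative bounded cohomology classes on a relative cycle. -/
def pairing (E : relCycles Γ H) : RelBoundedH2 Γ H →ₗ[ℝ] ℝ :=
  Submodule.liftQ _ ((evalChain E.1).comp (relBoundedCocycles Γ H).subtype) (by
    rintro ⟨x, hx⟩ ⟨h, -, rfl⟩
    have hE := E.2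
    simp only [relCycles, Submodule.mem_mk, AddSubmonoid.mem_mk, AddSubsemigroup.mem_mk,
      Set.mem_ofPred_eq] at hE
    simp only [LinearMap.mem_ker, LinearMap.comp_apply, Submodule.subtype_apply]
    simp only [evalChain, relDelta₁, LinearMap.coe_mk, AddHom.coe_mk]
    rw [linearCombination_delta₁, hE, map_sum, sub_eq_zero]
    refine Finset.sum_congr rfl fun i _ => ?_
    rw [Finsupp.linearCombination_mapDomain]
    rfl)

end Homology

/-! ### The fundamental group of the thrice-punctured sphere -/

/-- `π₁(Σ₃) = ⟨c₁, c₂, c₃ : c₁ c₂ c₃ = 1⟩`; the generators are indexed by `0, 1, 2`. -/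
abbrev PiOne : Type :=
  PresentedGroup
    ({FreeGroup.of 0 * FreeGroup.of 1 * FreeGroup.of 2} : Set (FreeGroup (Fin 3)))

/-- The generator of `π₁(Σ₃)` given by a loop around a puncture. -/
def gen (i : Fin 3) : PiOne := PresentedGroup.of i

lemma gen_mul : gen 0 * gen 1 * gen 2 = 1 :=
  PresentedGroup.one_of_mem (Set.mem_singleton _)

/-- The family of peripheral subgroups `∂π₁(Σ₃) = {⟨c₁⟩, ⟨c₂⟩, ⟨c₃⟩}`. -/
def peripheral (i : Fin 3) : Subgroup PiOne := Subgroup.zpowers (gen i)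

instance (i : Fin 3) : IsCyclic (peripheral i) :=
  inferInstanceAs (IsCyclic (Subgroup.zpowers (gen i)))

/-- The fundamental class of `(π₁(Σ₃), ∂π₁(Σ₃))`, represented by the relative cycle
`(e, c₁, c₂, c₃)` with `e = (c₁, c₂) + (c₁ c₂, c₃) + (1, 1)`. -/
def fundamentalCycle : relCycles PiOne peripheral :=
  ⟨(Finsupp.single (gen 0, gen 1) 1 + Finsupp.single (gen 0 * gen 1, gen 2) 1
      + Finsupp.single (1, 1) 1,
    fun i => Finsupp.single ⟨gen i, Subgroup.mem_zpowers (gen i)⟩ 1), by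
    simp only [relCycles, Submodule.mem_mk, AddSubmonoid.mem_mk, AddSubsemigroup.mem_mk,
      Set.mem_ofPred_eq]
    simp only [boundary₂, map_add, Finsupp.lsum_single, LinearMap.toSpanSingleton_apply, one_smul,
      gen_mul, mul_one, Finsupp.mapDomain_single, Fin.sum_univ_three]
    abel⟩

/-! ### Hyperbolic geometry -/

/-- The action of `PSL(2, ℝ)` on the upper half-plane by Möbius transformations. -/
instance : MulAction PSL(2, ℝ) ℍ :=
  MulAction.compHom ℍ
    (QuotientGroup.lift (Subgroup.center SL(2, ℝ)) (MulAction.toPermHom SL(2, ℝ) ℍ) (by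
      intro A hA
      obtain ⟨r, hr, hr'⟩ := Matrix.SpecialLinearGroup.mem_center_iff.1 hA
      have hr0 : r ≠ 0 := by
        rintro rfl
        simp at hr
      ext z
      have h00 : A.1 0 0 = r := by rw [← hr']; simp
      have h01 : A.1 0 1 = 0 := by rw [← hr']; simp
      have h10 : A.1 1 0 = 0 := by rw [← hr']; simp
      have h11 : A.1 1 1 = r := by rw [← hr']; simp
      have hrc : (r : ℂ) ≠ 0 := by exact_mod_cast hr0
      simp [UpperHalfPlane.coe_specialLinearGroup_apply, h00, h01, h10, h11, hrc]))

lemma mk_smul (A : SL(2, ℝ)) (z : ℍ) : ((A : PSL(2, ℝ)) • z : ℍ) = A • z := rfl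

/-- An element of `PSL(2, ℝ)` is elliptic if it has a unique fixed point in the upper
half-plane. -/
def IsElliptic (A : PSL(2, ℝ)) : Prop := ∃! z : ℍ, A • z = z

/-- The fixed point of an elliptic element. -/
def IsElliptic.fix {A : PSL(2, ℝ)} (hA : IsElliptic A) : ℍ := hA.choose

lemma IsElliptic.smul_fix {A : PSL(2, ℝ)} (hA : IsElliptic A) : A • hA.fix = hA.fix :=
  hA.choose_spec.1

/-- The geodesic segment between two points, for the hyperbolic distance. -/
def geodesicSegment (p q : ℍ) : Set ℍ := {w | dist p w + dist w q = dist p q}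

/-- The (solid) geodesic triangle with given vertices: the union of the geodesic segments from the
first vertex to the points of the opposite side. -/
def triangle (p q r : ℍ) : Set ℍ := ⋃ w ∈ geodesicSegment q r, geodesicSegment p w

/-- The orientation of a triple of points of the upper half-plane: `1` if the geodesic triangle is
anti-clockwise, `-1` if it is clockwise, and `0` if the points lie on a common geodesic. The
geodesics are the curves `a + b x + c |z|² = 0`, so the determinant vanishes exactly on the triples
lying on a common geodesic. -/
def orientationSign (p q r : ℍ) : SignType :=
  SignType.sign (Matrix.det !![1, p.re, Complex.normSq p;
                               1, q.re, Complex.normSq q;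
                               1, r.re, Complex.normSq r])

/-- The signed area `[Δ(p, q, r)]`. The unit `o` is the choice of an orientation of the upper
half-plane: anti-clockwise triangles have nonnegative area for `o = 1` and clockwise triangles have
nonnegative area for `o = -1`. The measure `volume` on `ℍ` is the hyperbolic area
`dx dy / y ^ 2`. -/
def signedArea (o : ℤˣ) (p q r : ℍ) : ℝ :=
  ((o : ℤ) : ℝ) * (orientationSign p q r : ℝ) * (volume (triangle p q r)).toReal

/-! ### The volume of a representation -/

/-- The area cochain `c(A₁, A₂) = [Δ(z, A₁ z, A₁ A₂ z)]` with base point `z`. -/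
def areaCochain (o : ℤˣ) (z : ℍ) (A : PSL(2, ℝ) × PSL(2, ℝ)) : ℝ :=
  signedArea o z (A.1 • z) ((A.1 * A.2) • z)

/-- The volume of a representation of `π₁(Σ₃)` into `PSL(2, ℝ)`: the evaluation of
`j⁻¹(φ^* κ)` on the fundamental class, where `κ` is the class of the area cocycle. -/
def vol (o : ℤˣ) (z : ℍ) (φ : PiOne →* PSL(2, ℝ)) : ℝ :=
  pairing fundamentalCycle
    ((jEquiv PiOne peripheral).symm (BoundedH2.pullback φ (boundedClass (areaCochain o z))))

end PuncturedSphere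

end

/-!
The proof works in the projective coordinates `(re z, |z|²)` of the upper half-plane, in which
geodesic segments are straight segments (`mem_geodesicSegment_iff`) and solid triangles are convex
hulls (`mem_triangle_iff`). Up to a null set, a triangle is then the set of points lying to the left
of its three sides (or to the right of them), so that the signed area of `Δ(p, q, r)` is the
integral of an explicit function `windingNumber p q r` (`signedArea_eq_integral`). The cocycle
identity holds already for these functions, by the Grassmann-Plücker relation between the
orientations of the triples of points (`windingNumber_cocycle`). Areas are bounded since every point
of a triangle lies above one of its edges, and the region above a geodesic has area `π`
(`volume_triangle_le`). Hence the signed area is a bounded alternating cocycle, invariant under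
`PSL(2, ℝ)`, and it changes sign under reflections.

In cohomology, moving the base point of the area cocycle changes it by the coboundary of a bounded
cochain (`boundedClass_areaCochain`). As `Cᵢ` is fixed by the `i`-th peripheral subgroup, coning off
from `Cᵢ` gives the bounded primitive `g ↦ [Δ(Cᵢ, z, φ(g) z)]` of the area cocycle there, and hence
the volume as a finite sum of signed areas (`vol_eq`). With the base point `C₂` and `D = φ(c₁) C₂`,
the sum is `-[Δ(C₁, C₂, D)] - [Δ(C₂, C₃, D)]`, which is
`-[Δ(C₁, C₂, C₃)] - [Δ(C₁, C₃, D)]` by the cocycle identity. Since `φ(c₁)` fixes `C₁` and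
`φ(c₃)` fixes `C₃` and maps `D` to `C₂`, the points `D` and `C₂` have the same distances to `C₁` and
to `C₃`. Hence (`eq_or_signedArea_eq_neg`) either `D` is the mirror image of `C₂` in the geodesic
`C₁C₃`, and `[Δ(C₁, C₃, D)] = -[Δ(C₁, C₃, C₂)] = [Δ(C₁, C₂, C₃)]` (both sides vanish if `C₁ = C₃`),
or `D = C₂`, and then uniqueness of fixed points makes all three of them equal.
-/

noncomputable section

namespace PuncturedSphere

/-! ### The projective model of the upper half-plane -/

lemma normSq_coe (z : ℍ) : Complex.normSq z = z.re ^ 2 + z.im ^ 2 := by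
  rw [Complex.normSq_apply, UpperHalfPlane.coe_re, UpperHalfPlane.coe_im]; ring

/-- Points of the upper half-plane are determined by their projective coordinates. -/
lemma ext_re_normSq {z w : ℍ} (h : z.re = w.re) (h' : Complex.normSq z = Complex.normSq w) :
    z = w := by
  refine UpperHalfPlane.ext_re_im h ?_
  rw [normSq_coe, normSq_coe, h, add_right_inj] at h'
  exact (pow_left_inj₀ z.im_pos.le w.im_pos.le two_ne_zero).1 h'

/-- The image of the upper half-plane in projective coordinates is the inside of a parabola. -/
lemma exists_of_sq_lt {x n : ℝ} (h : x ^ 2 < n) :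
    ∃ z : ℍ, z.re = x ∧ Complex.normSq z = n := by
  refine ⟨⟨⟨x, √(n - x ^ 2)⟩, Real.sqrt_pos.2 (sub_pos.2 h)⟩, rfl, ?_⟩
  rw [normSq_coe]
  simp only [UpperHalfPlane.mk_re, UpperHalfPlane.mk_im]
  rw [Real.sq_sqrt (sub_pos.2 h).le]; ring

/-- The image of the upper half-plane in projective coordinates is convex. -/
lemma exists_convex_combination (k l : ℍ) {t : ℝ} (ht0 : 0 ≤ t) (ht1 : t ≤ 1) :
    ∃ w : ℍ, w.re = (1 - t) * k.re + t * l.re ∧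
      Complex.normSq w = (1 - t) * Complex.normSq k + t * Complex.normSq l := by
  refine exists_of_sq_lt ?_
  rw [normSq_coe, normSq_coe]
  have h1 : 0 < (1 - t) * k.im ^ 2 + t * l.im ^ 2 := by
    rcases ht0.eq_or_lt with rfl | h
    · simpa using pow_pos k.im_pos 2
    · have := l.im_pos
      have := mul_nonneg (sub_nonneg.2 ht1) (sq_nonneg k.im)
      positivity
  nlinarith [mul_nonneg (mul_nonneg ht0 (sub_nonneg.2 ht1)) (sq_nonneg (k.re - l.re))]

/-- Twice the signed Euclidean area of a triangle in projective coordinates. Its sign is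
`orientationSign`. -/
def orient (p q r : ℍ) : ℝ :=
  (q.re * Complex.normSq r - r.re * Complex.normSq q)
    - (p.re * Complex.normSq r - r.re * Complex.normSq p)
    + (p.re * Complex.normSq q - q.re * Complex.normSq p)

lemma orientationSign_eq (p q r : ℍ) : orientationSign p q r = SignType.sign (orient p q r) := by
  rw [orientationSign, orient, Matrix.det_fin_three]
  congr 1
  simp
  ring

lemma orient_swap (p q r : ℍ) : orient p r q = -orient p q r := by simp only [orient]; ring

lemma orient_rotate (p q r : ℍ) : orient q r p = orient p q r := by simp only [orient]; ring

lemma orient_self_left (p q : ℍ) : orient p p q = 0 := by simp only [orient]; ring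

lemma orient_self_right (p q : ℍ) : orient p q q = 0 := by simp only [orient]; ring

lemma orient_add (x p q r : ℍ) :
    orient x q r + orient p x r + orient p q x = orient p q r := by
  simp only [orient]; ring

/-- The Grassmann-Plücker relation. -/
lemma orient_pluecker (x a b c d : ℍ) :
    orient x a b * orient x c d - orient x a c * orient x b d + orient x a d * orient x b c
      = 0 := by
  simp only [orient]; ring

/-- The Lorentz form on the vectors `(1, re, |·|²)`, for which `p` has norm `p.im ^ 2`; dividing the
vectors by `im` gives the hyperboloid model. -/
def lorentz (p q : ℍ) : ℝ :=
  (Complex.normSq p + Complex.normSq q) / 2 - p.re * q.re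

lemma lorentz_self (p : ℍ) : lorentz p p = p.im ^ 2 := by
  rw [lorentz, normSq_coe]; ring

lemma cosh_dist_mul (p q : ℍ) : Real.cosh (dist p q) * (p.im * q.im) = lorentz p q := by
  rw [UpperHalfPlane.cosh_dist', lorentz, normSq_coe, normSq_coe]
  have := p.im_pos.ne'
  have := q.im_pos.ne'
  field_simp
  ring

lemma lorentz_sq_sub_pos {p q : ℍ} (h : p ≠ q) :
    0 < lorentz p q ^ 2 - p.im ^ 2 * q.im ^ 2 := by
  have h1 : 1 < Real.cosh (dist p q) := Real.one_lt_cosh.2 (dist_pos.2 h).ne'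
  have h2 : 0 < (p.im * q.im) ^ 2 := by have := p.im_pos; have := q.im_pos; positivity
  rw [← cosh_dist_mul]
  nlinarith [mul_pos h2 (sub_pos.2 h1)]

/-- Equality in the triangle inequality in terms of the hyperbolic cosines. -/
lemma add_eq_iff_cosh {a b c : ℝ} (ha : 0 ≤ a) (hb : 0 ≤ b) (hc : 0 ≤ c) :
    a + b = c ↔ 0 ≤ Real.cosh c - Real.cosh a * Real.cosh b ∧
      (Real.cosh c - Real.cosh a * Real.cosh b) ^ 2
        = (Real.cosh a ^ 2 - 1) * (Real.cosh b ^ 2 - 1) := by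
  have hsa := Real.sinh_nonneg_iff.2 ha
  have hsb := Real.sinh_nonneg_iff.2 hb
  rw [← Real.sinh_sq, ← Real.sinh_sq, ← mul_pow]
  constructor
  · rintro rfl
    rw [Real.cosh_add, add_sub_cancel_left]
    exact ⟨mul_nonneg hsa hsb, rfl⟩
  · rintro ⟨h, h'⟩
    have := (pow_left_inj₀ h (mul_nonneg hsa hsb) two_ne_zero).1 h'
    have h3 : Real.cosh (a + b) = Real.cosh c := by rw [Real.cosh_add]; linarith
    exact Real.cosh_strictMonoOn.injOn (add_nonneg ha hb : a + b ∈ Set.Ici 0) hc h3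

/-- The Gram determinant criterion for a point to lie on a geodesic segment. -/
lemma mem_geodesicSegment_iff_lorentz {p q w : ℍ} :
    w ∈ geodesicSegment p q ↔ 0 ≤ lorentz p q * w.im ^ 2 - lorentz p w * lorentz w q ∧
      (lorentz p q * w.im ^ 2 - lorentz p w * lorentz w q) ^ 2
        = (lorentz p w ^ 2 - p.im ^ 2 * w.im ^ 2) * (lorentz w q ^ 2 - w.im ^ 2 * q.im ^ 2) := by
  have hp := p.im_pos
  have hq := q.im_pos
  have hw := w.im_pos
  have hk : 0 < p.im * q.im * w.im ^ 2 := by positivity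
  rw [geodesicSegment, Set.mem_ofPred_eq, add_eq_iff_cosh dist_nonneg dist_nonneg dist_nonneg]
  simp only [← cosh_dist_mul]
  generalize Real.cosh (dist p q) = γ
  generalize Real.cosh (dist p w) = α
  generalize Real.cosh (dist w q) = β
  have e1 : γ * (p.im * q.im) * w.im ^ 2 - α * (p.im * w.im) * (β * (w.im * q.im))
      = (p.im * q.im * w.im ^ 2) * (γ - α * β) := by ring
  have e2 : ((α * (p.im * w.im)) ^ 2 - p.im ^ 2 * w.im ^ 2)
      * ((β * (w.im * q.im)) ^ 2 - w.im ^ 2 * q.im ^ 2)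
      = (p.im * q.im * w.im ^ 2) ^ 2 * ((α ^ 2 - 1) * (β ^ 2 - 1)) := by ring
  rw [e1, e2, mul_pow, mul_right_inj' (pow_pos hk 2).ne', mul_nonneg_iff_of_pos_left hk]

/-- Geodesic segments are straight segments in projective coordinates. -/
lemma mem_geodesicSegment_iff {p q w : ℍ} :
    w ∈ geodesicSegment p q ↔ ∃ t : ℝ, 0 ≤ t ∧ t ≤ 1 ∧ w.re = (1 - t) * p.re + t * q.re ∧
      Complex.normSq w = (1 - t) * Complex.normSq p + t * Complex.normSq q := by
  rcases eq_or_ne p q with rfl | hpq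
  · constructor
    · intro h
      rw [geodesicSegment, Set.mem_ofPred_eq, dist_self, dist_comm w p] at h
      have : p = w := dist_le_zero.1 (by linarith)
      exact ⟨0, le_rfl, zero_le_one, by simp [this]⟩
    · rintro ⟨t, -, -, h, h'⟩
      have : w = p := ext_re_normSq (by rw [h]; ring) (by rw [h']; ring)
      simp [geodesicSegment, this]
  have hΔ := lorentz_sq_sub_pos hpq
  -- on the line through `p` and `q`, the Gram determinants factor
  have key : ∀ t : ℝ, w.re = (1 - t) * p.re + t * q.re →
      Complex.normSq w = (1 - t) * Complex.normSq p + t * Complex.normSq q →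
      lorentz p q * w.im ^ 2 - lorentz p w * lorentz w q
        = t * (1 - t) * (lorentz p q ^ 2 - p.im ^ 2 * q.im ^ 2) ∧
      lorentz p w ^ 2 - p.im ^ 2 * w.im ^ 2
        = t ^ 2 * (lorentz p q ^ 2 - p.im ^ 2 * q.im ^ 2) ∧
      lorentz w q ^ 2 - w.im ^ 2 * q.im ^ 2
        = (1 - t) ^ 2 * (lorentz p q ^ 2 - p.im ^ 2 * q.im ^ 2) := by
    intro t h1 h2
    simp only [← lorentz_self, lorentz, h1, h2]
    refine ⟨?_, ?_, ?_⟩ <;> ring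
  rw [mem_geodesicSegment_iff_lorentz]
  constructor
  · rintro ⟨h1, h2⟩
    -- the Gram determinant of the three vectors is a multiple of the square of their determinant
    have hdet : orient p w q = 0 := by
      have e : (lorentz p q * w.im ^ 2 - lorentz p w * lorentz w q) ^ 2
        - (lorentz p w ^ 2 - p.im ^ 2 * w.im ^ 2) * (lorentz w q ^ 2 - w.im ^ 2 * q.im ^ 2)
        = - w.im ^ 2 * orient p w q ^ 2 / 4 := by
        simp only [← lorentz_self, lorentz, orient]; ring
      rw [h2, sub_self] at e
      have := w.im_pos
      have : w.im ^ 2 * orient p w q ^ 2 = 0 := by linarith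
      simpa [w.im_pos.ne'] using this
    have hex : ∃ t : ℝ, w.re = (1 - t) * p.re + t * q.re ∧
        Complex.normSq w = (1 - t) * Complex.normSq p + t * Complex.normSq q := by
      simp only [orient] at hdet
      by_cases hre : p.re = q.re
      · have hn : Complex.normSq q - Complex.normSq p ≠ 0 := fun h =>
          hpq (ext_re_normSq hre (by linarith))
        refine ⟨(Complex.normSq w - Complex.normSq p)
          / (Complex.normSq q - Complex.normSq p), ?_, ?_⟩
        · rw [← hre] at hdet ⊢
          have : (w.re - p.re) * (Complex.normSq q - Complex.normSq p) = 0 := by linarith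
          have := (mul_eq_zero.1 this).resolve_right hn
          linarith
        · field_simp
          ring
      · have hn : q.re - p.re ≠ 0 := fun h => hre (by linarith)
        refine ⟨(w.re - p.re) / (q.re - p.re), ?_, ?_⟩
        · field_simp
          ring
        · field_simp
          linarith
    obtain ⟨t, ht1, ht2⟩ := hex
    rw [(key t ht1 ht2).1] at h1
    have := nonneg_of_mul_nonneg_left h1 hΔ
    exact ⟨t, by nlinarith, by nlinarith, ht1, ht2⟩
  · rintro ⟨t, h0, h1, ht1, ht2⟩
    obtain ⟨k1, k2, k3⟩ := key t ht1 ht2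
    rw [k1, k2, k3]
    refine ⟨mul_nonneg (mul_nonneg h0 (by linarith)) hΔ.le, by ring⟩

/-- Solid triangles are the convex hulls of their vertices in projective coordinates. -/
lemma mem_triangle_iff {p q r x : ℍ} :
    x ∈ triangle p q r ↔ ∃ a b c : ℝ, 0 ≤ a ∧ 0 ≤ b ∧ 0 ≤ c ∧ a + b + c = 1 ∧
      x.re = a * p.re + b * q.re + c * r.re ∧
      Complex.normSq x = a * Complex.normSq p + b * Complex.normSq q + c * Complex.normSq r := by
  simp only [triangle, Set.mem_iUnion, exists_prop, mem_geodesicSegment_iff]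
  constructor
  · rintro ⟨w, ⟨t, ht0, ht1, hw, hw'⟩, s, hs0, hs1, hx, hx'⟩
    refine ⟨1 - s, s * (1 - t), s * t, by linarith, mul_nonneg hs0 (by linarith),
      mul_nonneg hs0 ht0, by ring, ?_, ?_⟩
    · rw [hx, hw]; ring
    · rw [hx', hw']; ring
  · rintro ⟨a, b, c, ha, hb, hc, habc, hx, hx'⟩
    rcases eq_or_lt_of_le (add_nonneg hb hc) with h0 | h0
    · have hb0 : b = 0 := by linarith
      have hc0 : c = 0 := by linarith
      have ha1 : a = 1 := by linarith
      subst hb0 hc0 ha1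
      exact ⟨q, ⟨0, le_rfl, zero_le_one, by simp, by simp⟩, 0, le_rfl, zero_le_one,
        by rw [hx]; ring, by rw [hx']; ring⟩
    · have hbc : b / (b + c) = 1 - c / (b + c) := by field_simp; ring
      have hc' : 0 ≤ c / (b + c) := by positivity
      have hc1 : c / (b + c) ≤ 1 := by rw [div_le_one h0]; linarith
      obtain ⟨w, hw, hw'⟩ := exists_convex_combination q r hc' hc1
      refine ⟨w, ⟨c / (b + c), hc', hc1, hw, hw'⟩, b + c, h0.le, by linarith, ?_, ?_⟩
      · rw [hx, hw, ← hbc, show a = 1 - (b + c) by linarith]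
        field_simp
        ring
      · rw [hx', hw', ← hbc, show a = 1 - (b + c) by linarith]
        field_simp
        ring

lemma triangle_swap (p q r : ℍ) : triangle p r q = triangle p q r := by
  ext x
  simp only [mem_triangle_iff]
  constructor <;>
  · rintro ⟨a, b, c, ha, hb, hc, h, h1, h2⟩
    exact ⟨a, c, b, ha, hc, hb, by linarith, by linarith, by linarith⟩

lemma triangle_rotate (p q r : ℍ) : triangle q r p = triangle p q r := by
  ext x
  simp only [mem_triangle_iff]
  constructor
  · rintro ⟨a, b, c, ha, hb, hc, h, h1, h2⟩
    exact ⟨c, a, b, hc, ha, hb, by linarith, by linarith, by linarith⟩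
  · rintro ⟨a, b, c, ha, hb, hc, h, h1, h2⟩
    exact ⟨b, c, a, hb, hc, ha, by linarith, by linarith, by linarith⟩

/-- Cramer's rule: barycentric coordinates are ratios of determinants. -/
lemma mem_triangle_iff_orient {p q r x : ℍ} (h : 0 < orient p q r) :
    x ∈ triangle p q r ↔ 0 ≤ orient x q r ∧ 0 ≤ orient p x r ∧ 0 ≤ orient p q x := by
  rw [mem_triangle_iff]
  constructor
  · rintro ⟨a, b, c, ha, hb, hc, habc, h1, h2⟩
    obtain rfl : a = 1 - b - c := by linarith
    have e1 : orient x q r = (1 - b - c) * orient p q r := by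
      simp only [orient, h1, h2]; ring
    have e2 : orient p x r = b * orient p q r := by
      simp only [orient, h1, h2]; ring
    have e3 : orient p q x = c * orient p q r := by
      simp only [orient, h1, h2]; ring
    rw [e1, e2, e3]
    exact ⟨mul_nonneg ha h.le, mul_nonneg hb h.le, mul_nonneg hc h.le⟩
  · rintro ⟨h1, h2, h3⟩
    refine ⟨orient x q r / orient p q r, orient p x r / orient p q r, orient p q x / orient p q r,
      by positivity, by positivity, by positivity, ?_, ?_, ?_⟩
    · rw [← add_div, ← add_div, orient_add, div_self h.ne']
    · rw [div_mul_eq_mul_div, div_mul_eq_mul_div, div_mul_eq_mul_div, ← add_div, ← add_div,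
        eq_div_iff h.ne']
      simp only [orient]; ring
    · rw [div_mul_eq_mul_div, div_mul_eq_mul_div, div_mul_eq_mul_div, ← add_div, ← add_div,
        eq_div_iff h.ne']
      simp only [orient]; ring

/-! ### Isometries -/

section Moebius

open UpperHalfPlane

variable (g : GL (Fin 2) ℝ)

lemma re_smul_mul (z : ℍ) : (g • z).re * Complex.normSq (denom g z)
    = g 0 0 * g 1 0 * Complex.normSq z + (g 0 0 * g 1 1 + g 0 1 * g 1 0) * z.re
      + g 0 1 * g 1 1 := by
  have hN := normSq_denom_ne_zero g z.im_ne_zero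
  rw [re_smul, Complex.div_re, add_mul, div_mul_cancel₀ _ hN, div_mul_cancel₀ _ hN, normSq_coe]
  simp [num, denom]
  ring

lemma normSq_smul_mul (z : ℍ) : Complex.normSq ↑(g • z) * Complex.normSq (denom g z)
    = g 0 0 ^ 2 * Complex.normSq z + 2 * (g 0 0 * g 0 1) * z.re + g 0 1 ^ 2 := by
  have hN := normSq_denom_ne_zero g z.im_ne_zero
  rw [coe_smul, Complex.normSq_eq_norm_sq, norm_σ, ← Complex.normSq_eq_norm_sq, Complex.normSq_div,
    div_mul_cancel₀ _ hN, normSq_coe]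
  simp [num, Complex.normSq_apply]
  ring

lemma normSq_denom (z : ℍ) : Complex.normSq (denom g z)
    = g 1 0 ^ 2 * Complex.normSq z + 2 * (g 1 0 * g 1 1) * z.re + g 1 1 ^ 2 := by
  rw [normSq_coe]
  simp [denom, Complex.normSq_apply]
  ring

/-- The action on projective coordinates is the symmetric square of the standard representation, up
to scalars; its determinant is the cube of the determinant. -/
lemma orient_smul (p q r : ℍ) : orient (g • p) (g • q) (g • r)
    * (Complex.normSq (denom g p) * Complex.normSq (denom g q) * Complex.normSq (denom g r))
    = g.det.val ^ 3 * orient p q r := by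
  have e : orient (g • p) (g • q) (g • r)
    * (Complex.normSq (denom g p) * Complex.normSq (denom g q) * Complex.normSq (denom g r))
    = ((((g • q).re * Complex.normSq (denom g q)) *
          (Complex.normSq ↑(g • r) * Complex.normSq (denom g r))
        - ((g • r).re * Complex.normSq (denom g r)) *
          (Complex.normSq ↑(g • q) * Complex.normSq (denom g q))) * Complex.normSq (denom g p)
      - (((g • p).re * Complex.normSq (denom g p)) *
          (Complex.normSq ↑(g • r) * Complex.normSq (denom g r))
        - ((g • r).re * Complex.normSq (denom g r)) *
          (Complex.normSq ↑(g • p) * Complex.normSq (denom g p))) * Complex.normSq (denom g q)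
      + (((g • p).re * Complex.normSq (denom g p)) *
          (Complex.normSq ↑(g • q) * Complex.normSq (denom g q))
        - ((g • q).re * Complex.normSq (denom g q)) *
          (Complex.normSq ↑(g • p) * Complex.normSq (denom g p))) * Complex.normSq (denom g r)) := by
    simp only [orient]; ring
  rw [e]
  simp only [re_smul_mul, normSq_smul_mul]
  simp only [normSq_denom]
  rw [Matrix.GeneralLinearGroup.val_det_apply, Matrix.det_fin_two]
  simp only [orient]
  ring

lemma lorentz_smul (p q : ℍ) :
    lorentz (g • p) (g • q) * (Complex.normSq (denom g p) * Complex.normSq (denom g q))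
    = g.det.val ^ 2 * lorentz p q := by
  have e : lorentz (g • p) (g • q) * (Complex.normSq (denom g p) * Complex.normSq (denom g q))
    = ((Complex.normSq ↑(g • p) * Complex.normSq (denom g p)) * Complex.normSq (denom g q)
      + (Complex.normSq ↑(g • q) * Complex.normSq (denom g q)) * Complex.normSq (denom g p)) / 2
      - ((g • p).re * Complex.normSq (denom g p)) * ((g • q).re * Complex.normSq (denom g q)) := by
    simp only [lorentz]; ring
  rw [e]
  simp only [re_smul_mul, normSq_smul_mul]
  simp only [normSq_denom]
  rw [Matrix.GeneralLinearGroup.val_det_apply, Matrix.det_fin_two]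
  simp only [lorentz]
  ring

/-- `GL(2, ℝ)` acts by isometries. -/
lemma dist_smul_GL (p q : ℍ) : dist (g • p) (g • q) = dist p q := by
  have hP := normSq_denom_pos g p.im_ne_zero
  have hQ := normSq_denom_pos g q.im_ne_zero
  have h := lorentz_smul g p q
  rw [← cosh_dist_mul, ← cosh_dist_mul, im_smul_eq_div_normSq, im_smul_eq_div_normSq,
    ← sq_abs] at h
  have hg : 0 < |g.det.val| := abs_pos.2 g.det.ne_zero
  have hp := p.im_pos
  have hq := q.im_pos
  have hk : |g.det.val| ^ 2 * (p.im * q.im) ≠ 0 := by positivity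
  have hc : Real.cosh (dist (g • p) (g • q)) = Real.cosh (dist p q) := by
    refine mul_right_cancel₀ hk ?_
    rw [show Real.cosh (dist p q) * (|g.det.val| ^ 2 * (p.im * q.im))
      = |g.det.val| ^ 2 * (Real.cosh (dist p q) * (p.im * q.im)) by ring, ← h]
    field_simp
  exact Real.cosh_strictMonoOn.injOn (dist_nonneg : dist (g • p) (g • q) ∈ Set.Ici 0)
    (dist_nonneg : dist p q ∈ Set.Ici 0) hc

lemma smul_mem_triangle_iff (p q r x : ℍ) :
    g • x ∈ triangle (g • p) (g • q) (g • r) ↔ x ∈ triangle p q r := by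
  have hs : ∀ a b w : ℍ, g • w ∈ geodesicSegment (g • a) (g • b) ↔ w ∈ geodesicSegment a b := by
    intro a b w
    simp only [geodesicSegment, Set.mem_ofPred_eq, dist_smul_GL]
  simp only [triangle, Set.mem_iUnion, exists_prop]
  constructor
  · rintro ⟨w, hw, hx⟩
    rw [← smul_inv_smul g w, hs] at hw hx
    exact ⟨_, hw, hx⟩
  · rintro ⟨w, hw, hx⟩
    exact ⟨g • w, (hs _ _ _).2 hw, (hs _ _ _).2 hx⟩

lemma volume_triangle_smul (p q r : ℍ) :
    volume (triangle (g • p) (g • q) (g • r)) = volume (triangle p q r) := by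
  rw [← measure_smul (μ := volume) g (triangle p q r)]
  congr 1
  ext x
  rw [Set.mem_smul_set_iff_inv_smul_mem, ← smul_mem_triangle_iff g p q r, smul_inv_smul]

end Moebius

/-! ### Hyperbolic area -/

/-- Lebesgue null sets of the half-plane are null for the hyperbolic area. -/
lemma volume_eq_zero_of_subset {s : Set ℍ} {t : Set (ℝ × ℝ)}
    (ht : MeasurableSet t) (h0 : volume t = 0) (hst : ∀ z ∈ s, (z.re, z.im) ∈ t) :
    volume s = 0 := by
  rw [UpperHalfPlane.volume_eq_lintegral]
  refine setLIntegral_measure_zero _ _ ?_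
  refine measure_mono_null (t := Complex.measurableEquivRealProd ⁻¹' t) ?_ ?_
  · rintro _ ⟨z, hz, rfl⟩
    exact hst z hz
  · rw [Complex.volume_preserving_equiv_real_prod.measure_preimage ht.nullMeasurableSet, h0]

/-- Complete geodesics have area zero. -/
lemma volume_geodesic {A B C : ℝ} (h : B ≠ 0 ∨ C ≠ 0) :
    volume {z : ℍ | A + B * z.re + C * Complex.normSq z = 0} = 0 := by
  have hm : MeasurableSet {v : ℝ × ℝ | A + B * v.1 + C * (v.1 ^ 2 + v.2 ^ 2) = 0} :=
    measurableSet_eq_fun (by fun_prop) (by fun_prop)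
  refine volume_eq_zero_of_subset hm ?_ fun z hz => ?_
  · rw [Measure.volume_eq_prod, Measure.measure_prod_null hm]
    rcases eq_or_ne C 0 with rfl | hC
    · have hB : B ≠ 0 := h.resolve_right (by simp)
      have : ∀ᵐ x : ℝ, x ∉ ({-A / B} : Set ℝ) :=
        measure_eq_zero_iff_ae_notMem.1 (measure_singleton (-A / B))
      filter_upwards [this] with x hx
      rw [Pi.zero_apply]
      convert measure_empty (μ := (volume : Measure ℝ))
      ext y
      simp only [Set.mem_preimage, Set.mem_ofPred_eq, Set.mem_empty_iff_false, iff_false]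
      intro hy
      refine hx ?_
      rw [Set.mem_singleton_iff, eq_div_iff hB]
      linarith
    · refine Filter.Eventually.of_forall fun x => ?_
      refine Set.Finite.measure_zero ?_ _
      refine Set.Finite.subset (Set.toFinite
        {√(-(A + B * x + C * x ^ 2) / C), -√(-(A + B * x + C * x ^ 2) / C)}) fun y hy => ?_
      simp only [Set.mem_preimage, Set.mem_ofPred_eq] at hy
      have : y ^ 2 = -(A + B * x + C * x ^ 2) / C := by
        rw [eq_div_iff hC]; linarith
      rw [← this, Set.mem_insert_iff, Set.mem_singleton_iff, Real.sqrt_sq_eq_abs]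
      rcases abs_choice y with h | h <;> rw [h] <;> simp
  · simp only [Set.mem_ofPred_eq] at hz ⊢
    rwa [normSq_coe] at hz

/-- Almost every point is off the geodesic through two distinct points. -/
lemma ae_orient_ne_zero {p q : ℍ} (h : p ≠ q) : ∀ᵐ x : ℍ, orient x p q ≠ 0 := by
  have : q.re - p.re ≠ 0 ∨ Complex.normSq p - Complex.normSq q ≠ 0 := by
    by_contra! hc
    exact h (ext_re_normSq (by linarith) (by linarith))
  have h0 := volume_geodesic (A := p.re * Complex.normSq q - q.re * Complex.normSq p) this.symm
  refine measure_mono_null (fun x hx => ?_) h0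
  simp only [ne_eq, Set.mem_compl_iff, Set.mem_ofPred_eq, not_not, orient] at hx ⊢
  linarith

lemma lintegral_Ici_inv_sq {a : ℝ} (ha : 0 < a) :
    ∫⁻ y in Set.Ici a, ENNReal.ofReal (1 / y ^ 2) = ENNReal.ofReal (1 / a) := by
  have hd : ∀ x ∈ Set.Ici a, HasDerivAt (fun y : ℝ => -y⁻¹) (1 / x ^ 2) x := by
    intro x hx
    have h := (hasDerivAt_inv (ha.trans_le hx).ne').neg
    rw [neg_neg, ← one_div] at h
    exact h
  have hl : Filter.Tendsto (fun y : ℝ => -y⁻¹) Filter.atTop (nhds 0) := by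
    simpa using tendsto_inv_atTop_zero.neg (α := ℝ)
  have hi := integral_Ioi_of_hasDerivAt_of_nonneg' hd (fun x _ => by positivity) hl
  have hint := integrableOn_Ioi_deriv_of_nonneg' hd (fun x _ => by positivity) hl
  rw [setLIntegral_congr Ioi_ae_eq_Ici.symm, ← ofReal_integral_eq_lintegral_ofReal hint
    (Filter.Eventually.of_forall fun x => by positivity), hi]
  simp

lemma lintegral_inv_sqrt {c R : ℝ} (hR : 0 < R) :
    ∫⁻ x in Set.Ioc (c - R) (c + R), ENNReal.ofReal (1 / √(R ^ 2 - (x - c) ^ 2))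
      = ENNReal.ofReal Real.pi := by
  have hle : c - R ≤ c + R := by linarith
  have hcont : ContinuousOn (fun x => Real.arcsin ((x - c) / R)) (Set.uIcc (c - R) (c + R)) :=
    (Real.continuous_arcsin.comp (by fun_prop)).continuousOn
  have hd : ∀ x ∈ Set.Ioo (c - R) (c + R), HasDerivAt (fun x => Real.arcsin ((x - c) / R))
      (1 / √(R ^ 2 - (x - c) ^ 2)) x := by
    rintro x ⟨h1, h2⟩
    have h3 : (x - c) / R ≠ -1 := by rw [ne_eq, div_eq_iff hR.ne']; intro h; linarith
    have h4 : (x - c) / R ≠ 1 := by rw [ne_eq, div_eq_iff hR.ne']; intro h; linarith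
    have h5 := (Real.hasDerivAt_arcsin h3 h4).comp x (((hasDerivAt_id x).sub_const c).div_const R)
    refine h5.congr_deriv ?_
    have : R ^ 2 - (x - c) ^ 2 = R ^ 2 * (1 - ((x - c) / R) ^ 2) := by field_simp
    rw [this, Real.sqrt_mul (sq_nonneg R), Real.sqrt_sq hR.le]
    rw [div_mul_div_comm, one_mul, mul_comm]
  have hd' : ∀ x ∈ Set.Ioo (min (c - R) (c + R)) (max (c - R) (c + R)),
      HasDerivAt (fun x => Real.arcsin ((x - c) / R)) (1 / √(R ^ 2 - (x - c) ^ 2)) x := by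
    rwa [min_eq_left hle, max_eq_right hle]
  have hint := intervalIntegral.intervalIntegrable_deriv_of_nonneg hcont hd'
    (fun x _ => by positivity)
  have hi := intervalIntegral.integral_eq_sub_of_hasDerivAt_of_le hle
    (by rwa [Set.uIcc_of_le hle] at hcont) hd hint
  rw [intervalIntegral.integral_of_le hle] at hi
  rw [← ofReal_integral_eq_lintegral_ofReal ((intervalIntegrable_iff_integrableOn_Ioc_of_le hle).1
    hint) (Filter.Eventually.of_forall fun x => by positivity), hi]
  congr 1
  rw [show (c + R - c) / R = 1 by field_simp; ring, show (c - R - c) / R = -1 by field_simp; ring]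
  rw [Real.arcsin_one, Real.arcsin_neg, Real.arcsin_one]
  ring

/-- The part of the upper half-plane above a complete geodesic has area `π` (an ideal triangle with
a vertex at infinity). -/
lemma volume_above_le (c : ℝ) {R : ℝ} (hR : 0 < R) :
    volume {z : ℍ | (z.re - c) ^ 2 < R ^ 2 ∧ R ^ 2 ≤ (z.re - c) ^ 2 + z.im ^ 2}
      ≤ ENNReal.ofReal Real.pi := by
  set t : Set (ℝ × ℝ) := {v | (v.1 - c) ^ 2 < R ^ 2} ∩
    ({v | R ^ 2 ≤ (v.1 - c) ^ 2 + v.2 ^ 2} ∩ {v | 0 < v.2})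
  have ht : MeasurableSet t :=
    (measurableSet_lt (by fun_prop) (by fun_prop)).inter
      ((measurableSet_le (by fun_prop) (by fun_prop)).inter
        (measurableSet_lt (by fun_prop) (by fun_prop)))
  have hf : Measurable fun v : ℝ × ℝ => ENNReal.ofReal (1 / v.2 ^ 2) := by fun_prop
  have e1 : ∀ z : ℂ, (((1 / ‖z.im‖₊) ^ 2 : NNReal) : ENNReal)
      = ENNReal.ofReal (1 / z.im ^ 2) := by
    intro z
    rw [← ENNReal.ofReal_coe_nnreal]
    congr 1
    simp
  rw [UpperHalfPlane.volume_eq_lintegral]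
  simp only [e1]
  calc _ ≤ ∫⁻ z in Complex.measurableEquivRealProd ⁻¹' t, ENNReal.ofReal (1 / z.im ^ 2) := by
        refine lintegral_mono_set ?_
        rintro _ ⟨z, hz, rfl⟩
        exact ⟨hz.1, hz.2, z.im_pos⟩
    _ = ∫⁻ v in t, ENNReal.ofReal (1 / v.2 ^ 2) :=
        Complex.volume_preserving_equiv_real_prod.setLIntegral_comp_preimage ht hf
    _ = ∫⁻ v, t.indicator (fun v => ENNReal.ofReal (1 / v.2 ^ 2)) v :=
        (lintegral_indicator ht _).symm
    _ = ∫⁻ x, ∫⁻ y, t.indicator (fun v => ENNReal.ofReal (1 / v.2 ^ 2)) (x, y) := by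
        rw [Measure.volume_eq_prod, lintegral_prod _ (hf.indicator ht).aemeasurable]
    _ ≤ ∫⁻ x, (Set.Ioc (c - R) (c + R)).indicator
          (fun x => ENNReal.ofReal (1 / √(R ^ 2 - (x - c) ^ 2))) x := by
        refine lintegral_mono fun x => ?_
        by_cases hx : (x - c) ^ 2 < R ^ 2
        · have hx' := abs_lt.1 (abs_lt_of_sq_lt_sq hx hR.le)
          rw [Set.indicator_of_mem (Set.mem_Ioc.2 ⟨by linarith, by linarith⟩),
            ← lintegral_Ici_inv_sq (Real.sqrt_pos.2 (sub_pos.2 hx)),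
            ← lintegral_indicator measurableSet_Ici]
          refine lintegral_mono fun y => ?_
          by_cases hy : (x, y) ∈ t
          · rw [Set.indicator_of_mem hy, Set.indicator_of_mem]
            rw [Set.mem_Ici]
            refine Real.sqrt_le_iff.2 ⟨hy.2.2.le, ?_⟩
            have : R ^ 2 ≤ (x - c) ^ 2 + y ^ 2 := hy.2.1
            linarith
          · rw [Set.indicator_of_notMem hy]
            exact zero_le
        · have : ∀ y, (x, y) ∉ t := fun y hy => hx hy.1
          simp [this]
    _ = _ := by
        rw [lintegral_indicator measurableSet_Ioc, lintegral_inv_sqrt hR]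

/-- The region above a geodesic segment: the points lying vertically above one of its points, or
on it. -/
def above (p q : ℍ) : Set ℍ :=
  {x | ∃ w ∈ geodesicSegment p q, x.re = w.re ∧ Complex.normSq w ≤ Complex.normSq x}

lemma volume_above_segment_le (p q : ℍ) : volume (above p q) ≤ ENNReal.ofReal Real.pi := by
  by_cases hre : p.re = q.re
  · have h0 := volume_geodesic (A := -p.re) (B := 1) (C := 0) (Or.inl one_ne_zero)
    refine (measure_mono fun x hx => ?_).trans (h0.le.trans zero_le)
    obtain ⟨w, hw, hxw, -⟩ := hx
    obtain ⟨t, -, -, h, -⟩ := mem_geodesicSegment_iff.1 hw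
    rw [Set.mem_ofPred_eq, hxw, h, ← hre]
    ring
  · have hn : q.re - p.re ≠ 0 := fun h => hre (by linarith)
    -- centre and radius of the Euclidean half-circle through `p` and `q`
    obtain ⟨c, hc⟩ : ∃ c, 2 * c * (q.re - p.re) = Complex.normSq q - Complex.normSq p :=
      ⟨(Complex.normSq q - Complex.normSq p) / (2 * (q.re - p.re)), by field_simp⟩
    have hpos : 0 < (p.re - c) ^ 2 + p.im ^ 2 := by have := p.im_pos; positivity
    refine (measure_mono fun x hx => ?_).trans (volume_above_le c (Real.sqrt_pos.2 hpos))
    obtain ⟨w, hw, hxw, hxn⟩ := hx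
    obtain ⟨t, -, -, h, h'⟩ := mem_geodesicSegment_iff.1 hw
    have hw2 : Complex.normSq w - 2 * c * w.re = Complex.normSq p - 2 * c * p.re := by
      rw [h, h']
      linear_combination -t * hc
    have hwi := pow_pos w.im_pos 2
    simp only [normSq_coe] at hw2 hxn
    rw [Set.mem_ofPred_eq, Real.sq_sqrt hpos.le, hxw]
    rw [hxw] at hxn
    constructor <;> nlinarith

/-- Moving barycentric coordinates in a nonzero direction of total weight zero, one of them has to
reach zero first. -/
lemma exists_boundary_point {a b c u v w : ℝ} (ha : 0 ≤ a) (hb : 0 ≤ b) (hc : 0 ≤ c)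
    (huvw : u + v + w = 0) (hne : ¬ (u = 0 ∧ v = 0)) :
    ∃ t : ℝ, 0 ≤ t ∧ 0 ≤ a + t * u ∧ 0 ≤ b + t * v ∧ 0 ≤ c + t * w ∧
      (a + t * u = 0 ∨ b + t * v = 0 ∨ c + t * w = 0) := by
  set m : ℝ → ℝ := fun t => min (a + t * u) (min (b + t * v) (c + t * w)) with hm
  have hcont : Continuous m := by fun_prop
  have h0 : 0 ≤ m 0 := by simp [hm, ha, hb, hc]
  obtain ⟨T, hT0, hT⟩ : ∃ T, 0 ≤ T ∧ m T ≤ 0 := by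
    have key : ∀ x y : ℝ, 0 ≤ x → y < 0 → 0 ≤ x / -y ∧ x + x / -y * y ≤ 0 := by
      intro x y hx hy
      refine ⟨div_nonneg hx (by linarith), le_of_eq ?_⟩
      have := hy.ne
      field_simp
      ring
    rcases lt_or_ge u 0 with h | h
    · obtain ⟨h1, h2⟩ := key a u ha h
      exact ⟨_, h1, (min_le_left _ _).trans h2⟩
    rcases lt_or_ge v 0 with h' | h'
    · obtain ⟨h1, h2⟩ := key b v hb h'
      exact ⟨_, h1, (min_le_right _ _).trans ((min_le_left _ _).trans h2)⟩
    have h'' : w < 0 := by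
      by_contra hw
      push Not at hw
      exact hne ⟨by linarith, by linarith⟩
    obtain ⟨h1, h2⟩ := key c w hc h''
    exact ⟨_, h1, (min_le_right _ _).trans ((min_le_right _ _).trans h2)⟩
  obtain ⟨t, ⟨ht0, -⟩, ht⟩ := intermediate_value_Icc' hT0 hcont.continuousOn ⟨hT, h0⟩
  have h1 : 0 ≤ a + t * u := ht ▸ min_le_left _ _
  have h2 : 0 ≤ b + t * v := ht ▸ (min_le_right _ _).trans (min_le_left _ _)
  have h3 : 0 ≤ c + t * w := ht ▸ (min_le_right _ _).trans (min_le_right _ _)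
  refine ⟨t, ht0, h1, h2, h3, ?_⟩
  by_contra! hcon
  have h4 : 0 < m t := lt_min (lt_of_le_of_ne h1 hcon.1.symm)
    (lt_min (lt_of_le_of_ne h2 hcon.2.1.symm) (lt_of_le_of_ne h3 hcon.2.2.symm))
  exact h4.ne' ht

/-- Every point of a triangle lies above one of the edges. -/
lemma triangle_subset_above {p q r : ℍ} (h : 0 < orient p q r) :
    triangle p q r ⊆ above q r ∪ above r p ∪ above p q := by
  intro x hx
  obtain ⟨a, b, c, ha, hb, hc, habc, hre, hn⟩ := mem_triangle_iff.1 hx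
  -- the direction of barycentric coordinates along which `re` is constant and `normSq` decreases
  obtain ⟨t, ht, h1, h2, h3, h4⟩ := exists_boundary_point (u := q.re - r.re) (v := r.re - p.re)
    (w := p.re - q.re) ha hb hc (by ring) (by
      rintro ⟨hu, hv⟩
      have e1 : r.re = q.re := by linarith
      have e2 : p.re = q.re := by linarith
      simp only [orient, e1, e2] at h
      linarith)
  have hdown : (a + t * (q.re - r.re)) * Complex.normSq p
      + (b + t * (r.re - p.re)) * Complex.normSq q
      + (c + t * (p.re - q.re)) * Complex.normSq r ≤ Complex.normSq x := by
    have : 0 ≤ t * orient p q r := mul_nonneg ht h.le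
    simp only [orient] at this
    rw [hn]
    linarith
  have hflat : x.re = (a + t * (q.re - r.re)) * p.re
      + (b + t * (r.re - p.re)) * q.re + (c + t * (p.re - q.re)) * r.re := by
    rw [hre]; ring
  have hsum : (a + t * (q.re - r.re)) + (b + t * (r.re - p.re)) + (c + t * (p.re - q.re)) = 1 := by
    linarith
  generalize a + t * (q.re - r.re) = a' at *
  generalize b + t * (r.re - p.re) = b' at *
  generalize c + t * (p.re - q.re) = c' at *
  have key : ∀ (k l : ℍ) (s : ℝ), 0 ≤ s → s ≤ 1 → x.re = (1 - s) * k.re + s * l.re →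
      (1 - s) * Complex.normSq k + s * Complex.normSq l ≤ Complex.normSq x → x ∈ above k l := by
    intro k l s hs0 hs1 e1 e2
    obtain ⟨w, hw1, hw2⟩ := exists_convex_combination k l hs0 hs1
    exact ⟨w, mem_geodesicSegment_iff.2 ⟨s, hs0, hs1, hw1, hw2⟩, by rw [e1, hw1], by rwa [hw2]⟩
  rcases h4 with rfl | rfl | rfl
  · refine Or.inl (Or.inl (key q r c' h3 (by linarith) ?_ ?_))
    · rw [hflat, show b' = 1 - c' by linarith]; ring
    · rw [show b' = 1 - c' by linarith] at hdown; linarith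
  · refine Or.inl (Or.inr (key r p a' h1 (by linarith) ?_ ?_))
    · rw [hflat, show c' = 1 - a' by linarith]; ring
    · rw [show c' = 1 - a' by linarith] at hdown; linarith
  · refine Or.inr (key p q b' h2 (by linarith) ?_ ?_)
    · rw [hflat, show a' = 1 - b' by linarith]; ring
    · rw [show a' = 1 - b' by linarith] at hdown; linarith

lemma volume_triangle_le_of_pos {p q r : ℍ} (h : 0 < orient p q r) :
    volume (triangle p q r) ≤ ENNReal.ofReal (3 * Real.pi) := by
  refine (measure_mono (triangle_subset_above h)).trans ((measure_union_le _ _).trans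
    ((add_le_add (measure_union_le _ _) le_rfl).trans ?_))
  refine (add_le_add (add_le_add (volume_above_segment_le q r) (volume_above_segment_le r p))
    (volume_above_segment_le p q)).trans_eq ?_
  have := Real.pi_pos.le
  rw [← ENNReal.ofReal_add this this, ← ENNReal.ofReal_add (by positivity) this]
  congr 1
  ring

/-- Areas of nondegenerate hyperbolic triangles are uniformly bounded. -/
lemma volume_triangle_le {p q r : ℍ} (h : orient p q r ≠ 0) :
    volume (triangle p q r) ≤ ENNReal.ofReal (3 * Real.pi) := by
  rcases h.lt_or_gt with h | h
  · rw [← triangle_swap]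
    exact volume_triangle_le_of_pos (by rw [orient_swap]; linarith)
  · exact volume_triangle_le_of_pos h

/-! ### The signed area -/

/-- The points lying to the left of the three oriented sides of a triangle; this is the interior
of an anti-clockwise triangle, and empty for other triples. -/
def openTriangle (p q r : ℍ) : Set ℍ :=
  {x | 0 < orient x p q ∧ 0 < orient x q r ∧ 0 < orient x r p}

lemma mem_openTriangle {p q r x : ℍ} :
    x ∈ openTriangle p q r ↔ 0 < orient x p q ∧ 0 < orient x q r ∧ 0 < orient x r p := Iff.rfl

lemma openTriangle_eq_empty {p q r : ℍ} (h : orient p q r ≤ 0) : openTriangle p q r = ∅ := by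
  refine Set.eq_empty_of_forall_notMem fun x ⟨h1, h2, h3⟩ => ?_
  simp only [orient] at *
  linarith

lemma measurableSet_openTriangle (p q r : ℍ) : MeasurableSet (openTriangle p q r) := by
  have hc : ∀ a b : ℍ, Continuous fun x => orient x a b := by
    intro a b
    have h1 := UpperHalfPlane.continuous_re
    have h2 : Continuous fun x : ℍ => Complex.normSq x :=
      Complex.continuous_normSq.comp UpperHalfPlane.continuous_coe
    unfold orient
    fun_prop
  exact ((isOpen_lt continuous_const (hc p q)).inter ((isOpen_lt continuous_const (hc q r)).inter
    (isOpen_lt continuous_const (hc r p)))).measurableSet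

lemma openTriangle_subset_triangle {p q r : ℍ} (h : 0 < orient p q r) :
    openTriangle p q r ⊆ triangle p q r := by
  rintro x ⟨h1, h2, h3⟩
  rw [mem_triangle_iff_orient h]
  exact ⟨h2.le, orient_rotate p x r ▸ h3.le, (orient_rotate x p q).symm ▸ h1.le⟩

/-- The sides of a triangle have area zero. -/
lemma triangle_ae_eq_openTriangle {p q r : ℍ} (h : 0 < orient p q r) :
    triangle p q r =ᵐ[volume] openTriangle p q r := by
  have hpq : p ≠ q := by rintro rfl; rw [orient_self_left] at h; exact h.false
  have hqr : q ≠ r := by rintro rfl; rw [orient_self_right] at h; exact h.false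
  have hrp : r ≠ p := by
    rintro rfl; rw [← orient_rotate, orient_self_right] at h; exact h.false
  refine Filter.eventuallyEq_set.2 ?_
  filter_upwards [ae_orient_ne_zero hpq, ae_orient_ne_zero hqr, ae_orient_ne_zero hrp]
    with x h1 h2 h3
  refine ⟨fun hx => ?_, fun hx => openTriangle_subset_triangle h hx⟩
  obtain ⟨k2, k3, k1⟩ := (mem_triangle_iff_orient h).1 hx
  rw [orient_rotate x p q] at k1
  rw [← orient_rotate p x r] at k3
  exact ⟨lt_of_le_of_ne k1 h1.symm, lt_of_le_of_ne k2 h2.symm, lt_of_le_of_ne k3 h3.symm⟩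

lemma volume_openTriangle_lt_top (p q r : ℍ) : volume (openTriangle p q r) < ⊤ := by
  rcases lt_or_ge 0 (orient p q r) with h | h
  · exact (measure_mono (openTriangle_subset_triangle h)).trans_lt
      ((volume_triangle_le h.ne').trans_lt ENNReal.ofReal_lt_top)
  · rw [openTriangle_eq_empty h, measure_empty]
    exact ENNReal.zero_lt_top

/-- The density of the signed area: `1` inside an anti-clockwise triangle and `-1` inside a
clockwise one. -/
def windingNumber (p q r : ℍ) : ℍ → ℝ :=
  (openTriangle p q r).indicator 1 - (openTriangle p r q).indicator 1

lemma integrable_indicator_openTriangle (p q r : ℍ) :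
    Integrable ((openTriangle p q r).indicator (1 : ℍ → ℝ)) :=
  (integrable_indicator_iff (measurableSet_openTriangle p q r)).2
    (integrableOn_const (volume_openTriangle_lt_top p q r).ne)

lemma integrable_windingNumber (p q r : ℍ) : Integrable (windingNumber p q r) :=
  (integrable_indicator_openTriangle p q r).sub (integrable_indicator_openTriangle p r q)

lemma signedArea_swap (o : ℤˣ) (p q r : ℍ) : signedArea o p r q = -signedArea o p q r := by
  rw [signedArea, signedArea, orientationSign_eq, orientationSign_eq, orient_swap p q r,
    triangle_swap p q r, Left.sign_neg]
  simp

lemma signedArea_rotate (o : ℤˣ) (p q r : ℍ) : signedArea o q r p = signedArea o p q r := by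
  simp only [signedArea, orientationSign_eq, orient_rotate, triangle_rotate]

lemma signedArea_self_left (o : ℤˣ) (p q : ℍ) : signedArea o p p q = 0 := by
  simp [signedArea, orientationSign_eq, orient_self_left]

lemma signedArea_self_right (o : ℤˣ) (p q : ℍ) : signedArea o p q q = 0 := by
  rw [← signedArea_rotate o p q q, signedArea_self_left]

lemma signedArea_self_outer (o : ℤˣ) (p q : ℍ) : signedArea o p q p = 0 := by
  rw [← signedArea_rotate, signedArea_self_right]

lemma integral_windingNumber (p q r : ℍ) : ∫ x, windingNumber p q r x
    = volume.real (openTriangle p q r) - volume.real (openTriangle p r q) := by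
  rw [windingNumber, integral_sub' (integrable_indicator_openTriangle p q r)
      (integrable_indicator_openTriangle p r q),
    integral_indicator_one (measurableSet_openTriangle p q r),
    integral_indicator_one (measurableSet_openTriangle p r q)]

lemma signedArea_eq_integral (o : ℤˣ) (p q r : ℍ) :
    signedArea o p q r = ((o : ℤ) : ℝ) * ∫ x, windingNumber p q r x := by
  have hpos : ∀ p q r : ℍ, 0 < orient p q r →
      signedArea o p q r = ((o : ℤ) : ℝ) * ∫ x, windingNumber p q r x := by
    intro p q r h
    rw [integral_windingNumber, openTriangle_eq_empty (p := p) (q := r) (r := q)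
      (by rw [orient_swap]; linarith), signedArea, orientationSign_eq, sign_pos h,
      measure_congr (triangle_ae_eq_openTriangle h)]
    simp [Measure.real]
  rcases lt_trichotomy (orient p q r) 0 with h | h | h
  · rw [← neg_eq_iff_eq_neg.2 (signedArea_swap o p q r),
      hpos p r q (by rw [orient_swap]; linarith), integral_windingNumber, integral_windingNumber]
    ring
  · rw [integral_windingNumber, openTriangle_eq_empty h.le,
      openTriangle_eq_empty (by rw [orient_swap, h, neg_zero]), signedArea, orientationSign_eq, h]
    simp
  · exact hpos p q r h

/-- Four points in general position with respect to `x` form a tournament, whose cyclic triples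
are the triangles that contain `x`. The Grassmann-Plücker relation excludes the tournaments in which
a vertex beats or loses to all vertices of a cyclic triple, and in the others the identity holds. -/
lemma windingNumber_cocycle {a b c d x : ℍ} (hab : orient x a b ≠ 0) (hac : orient x a c ≠ 0)
    (had : orient x a d ≠ 0) (hbc : orient x b c ≠ 0) (hbd : orient x b d ≠ 0)
    (hcd : orient x c d ≠ 0) :
    windingNumber b c d x - windingNumber a c d x + windingNumber a b d x
      - windingNumber a b c x = 0 := by
  classical
  have hP := orient_pluecker x a b c d
  simp only [windingNumber, Pi.sub_apply, Set.indicator_apply, mem_openTriangle, Pi.one_apply]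
  rw [orient_swap x a b, orient_swap x a c, orient_swap x a d, orient_swap x b c,
    orient_swap x b d, orient_swap x c d]
  generalize orient x a b = ab at *
  generalize orient x a c = ac at *
  generalize orient x a d = ad at *
  generalize orient x b c = bc at *
  generalize orient x b d = bd at *
  generalize orient x c d = cd at *
  simp only [neg_pos]
  rcases hab.lt_or_gt with h1 | h1 <;> rcases hac.lt_or_gt with h2 | h2 <;>
  rcases had.lt_or_gt with h3 | h3 <;> rcases hbc.lt_or_gt with h4 | h4 <;>
  rcases hbd.lt_or_gt with h5 | h5 <;> rcases hcd.lt_or_gt with h6 | h6 <;>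
  simp only [h1, h2, h3, h4, h5, h6, h1.not_gt, h2.not_gt, h3.not_gt, h4.not_gt, h5.not_gt,
    h6.not_gt, and_true, and_false, if_true, if_false, and_self] <;>
  norm_num <;> nlinarith

/-- The signed area is a cocycle: decompositions of geodesic quadrilaterals. -/
lemma signedArea_cocycle (o : ℤˣ) (a b c d : ℍ) :
    signedArea o b c d - signedArea o a c d + signedArea o a b d - signedArea o a b c = 0 := by
  rcases eq_or_ne a b with rfl | hab
  · simp only [signedArea_self_left]; ring
  rcases eq_or_ne a c with rfl | hac
  · rw [signedArea_self_left, signedArea_self_outer, ← signedArea_rotate o b a d, signedArea_swap]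
    ring
  rcases eq_or_ne a d with rfl | had
  · rw [signedArea_self_outer, signedArea_self_outer, signedArea_rotate]; ring
  rcases eq_or_ne b c with rfl | hbc
  · rw [signedArea_self_left, signedArea_self_right]; ring
  rcases eq_or_ne b d with rfl | hbd
  · rw [signedArea_self_outer, signedArea_self_right, signedArea_swap]; ring
  rcases eq_or_ne c d with rfl | hcd
  · rw [signedArea_self_right, signedArea_self_right]; ring
  have hi := integrable_windingNumber
  have h0 : ∫ x, (windingNumber b c d x - windingNumber a c d x + windingNumber a b d x
      - windingNumber a b c x) = 0 := by
    refine integral_eq_zero_of_ae ?_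
    filter_upwards [ae_orient_ne_zero hab, ae_orient_ne_zero hac, ae_orient_ne_zero had,
      ae_orient_ne_zero hbc, ae_orient_ne_zero hbd, ae_orient_ne_zero hcd]
      with x h1 h2 h3 h4 h5 h6 using windingNumber_cocycle h1 h2 h3 h4 h5 h6
  have hi1 : Integrable fun x => windingNumber b c d x - windingNumber a c d x :=
    (hi b c d).sub (hi a c d)
  have hi2 : Integrable fun x => windingNumber b c d x - windingNumber a c d x
      + windingNumber a b d x := hi1.add (hi a b d)
  rw [integral_sub hi2 (hi a b c), integral_add hi1 (hi a b d),
    integral_sub (hi b c d) (hi a c d)] at h0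
  simp only [signedArea_eq_integral]
  linear_combination ((o : ℤ) : ℝ) * h0

lemma abs_signedArea_le (o : ℤˣ) (p q r : ℍ) : |signedArea o p q r| ≤ 3 * Real.pi := by
  have hpi : 0 ≤ 3 * Real.pi := by have := Real.pi_pos; positivity
  have ho : |((o : ℤ) : ℝ)| = 1 := by rcases Int.units_eq_one_or o with rfl | rfl <;> simp
  rcases eq_or_ne (orient p q r) 0 with h | h
  · simpa [signedArea, orientationSign_eq, h] using hpi
  · have h1 := ENNReal.toReal_mono ENNReal.ofReal_ne_top (volume_triangle_le h)
    rw [ENNReal.toReal_ofReal hpi] at h1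
    have hs : |((SignType.sign (orient p q r) : SignType) : ℝ)| = 1 := by
      rcases h.lt_or_gt with h | h <;> simp [h]
    rw [signedArea, orientationSign_eq, abs_mul, abs_mul, ho, hs, one_mul, one_mul,
      abs_of_nonneg ENNReal.toReal_nonneg]
    exact h1

lemma sign_orient_smul (g : GL (Fin 2) ℝ) (p q r : ℍ) :
    SignType.sign (orient (g • p) (g • q) (g • r))
      = SignType.sign g.det.val * SignType.sign (orient p q r) := by
  have h := congrArg SignType.sign (orient_smul g p q r)
  have hP := UpperHalfPlane.normSq_denom_pos g p.im_ne_zero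
  have hQ := UpperHalfPlane.normSq_denom_pos g q.im_ne_zero
  have hR := UpperHalfPlane.normSq_denom_pos g r.im_ne_zero
  rw [sign_mul, sign_pos (mul_pos (mul_pos hP hQ) hR), mul_one, sign_mul, sign_pow] at h
  rw [h]
  congr 1
  generalize SignType.sign g.det.val = s
  revert s
  decide

lemma signedArea_smul_GL (o : ℤˣ) (g : GL (Fin 2) ℝ) (p q r : ℍ) :
    signedArea o (g • p) (g • q) (g • r)
      = (SignType.sign g.det.val : ℝ) * signedArea o p q r := by
  rw [signedArea, signedArea, orientationSign_eq, orientationSign_eq, sign_orient_smul,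
    volume_triangle_smul]
  push_cast
  ring

lemma exists_GL_smul (A : PSL(2, ℝ)) :
    ∃ g : GL (Fin 2) ℝ, 0 < g.det.val ∧ ∀ z : ℍ, A • z = g • z := by
  obtain ⟨B, rfl⟩ := QuotientGroup.mk_surjective A
  refine ⟨Matrix.SpecialLinearGroup.mapGL ℝ B, by simp, fun z => ?_⟩
  rw [mk_smul]
  exact MulAction.compHom_smul_def _ _ _

lemma signedArea_smul (o : ℤˣ) (A : PSL(2, ℝ)) (p q r : ℍ) :
    signedArea o (A • p) (A • q) (A • r) = signedArea o p q r := by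
  obtain ⟨g, hg, h⟩ := exists_GL_smul A
  rw [h, h, h, signedArea_smul_GL, sign_pos hg]
  simp

lemma dist_smul_PSL (A : PSL(2, ℝ)) (p q : ℍ) : dist (A • p) (A • q) = dist p q := by
  obtain ⟨g, -, h⟩ := exists_GL_smul A
  rw [h, h, dist_smul_GL]

/-! ### Reflections -/

/-- Any two points can be moved to the imaginary axis. -/
lemma exists_smul_re_eq_zero (p q : ℍ) :
    ∃ g : GL (Fin 2) ℝ, (g • p).re = 0 ∧ (g • q).re = 0 := by
  have hre : ∀ (g : GL (Fin 2) ℝ) (z : ℍ), g 0 0 * g 1 0 * Complex.normSq z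
      + (g 0 0 * g 1 1 + g 0 1 * g 1 0) * z.re + g 0 1 * g 1 1 = 0 → (g • z).re = 0 := by
    intro g z h
    rw [← re_smul_mul] at h
    exact (mul_eq_zero.1 h).resolve_right (UpperHalfPlane.normSq_denom_ne_zero g z.im_ne_zero)
  by_cases h : p.re = q.re
  · refine ⟨.mkOfDetNeZero !![1, -p.re; 0, 1] (by simp), hre _ _ ?_, hre _ _ ?_⟩
    · simp [Matrix.GeneralLinearGroup.mkOfDetNeZero]
    · simp [Matrix.GeneralLinearGroup.mkOfDetNeZero, h]
  · have hn : q.re - p.re ≠ 0 := fun h' => h (by linarith)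
    -- send the end points `c - R` and `c + R` of the half-circle through `p`, `q` to `0` and `∞`
    obtain ⟨c, hc⟩ : ∃ c, 2 * c * (q.re - p.re) = Complex.normSq q - Complex.normSq p :=
      ⟨(Complex.normSq q - Complex.normSq p) / (2 * (q.re - p.re)), by field_simp⟩
    have hpos : 0 < (p.re - c) ^ 2 + p.im ^ 2 := by have := p.im_pos; positivity
    set R := √((p.re - c) ^ 2 + p.im ^ 2) with hR
    have hR0 : 0 < R := Real.sqrt_pos.2 hpos
    have hR2 : R ^ 2 = Complex.normSq p - 2 * c * p.re + c ^ 2 := by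
      rw [hR, Real.sq_sqrt hpos.le, normSq_coe]; ring
    refine ⟨.mkOfDetNeZero !![1, -(c - R); -1, c + R] ?_, hre _ _ ?_, hre _ _ ?_⟩
    · rw [Matrix.det_fin_two_of]; intro h; linarith
    · simp [Matrix.GeneralLinearGroup.mkOfDetNeZero]
      linear_combination hR2
    · simp [Matrix.GeneralLinearGroup.mkOfDetNeZero]
      linear_combination hR2 + hc

/-- A point is determined up to reflection by its distances to two distinct points. -/
lemma eq_or_eq_J_smul {p q z w : ℍ} (hp : p.re = 0) (hq : q.re = 0) (hpq : p ≠ q)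
    (h1 : dist p z = dist p w) (h2 : dist q z = dist q w) :
    w = z ∨ w = UpperHalfPlane.J • z := by
  have key : ∀ v : ℍ, v.re = 0 → dist v z = dist v w →
      (v.im ^ 2 + Complex.normSq z) * w.im = (v.im ^ 2 + Complex.normSq w) * z.im := by
    intro v hv h
    have e1 := cosh_dist_mul v z
    have e2 := cosh_dist_mul v w
    rw [h] at e1
    rw [lorentz, normSq_coe v, hv] at e1 e2
    have hv0 := v.im_pos.ne'
    refine mul_left_cancel₀ hv0 ?_
    linear_combination (-2 * v.im * w.im) * e1 + (2 * v.im * z.im) * e2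
  have k1 := key p hp h1
  have k2 := key q hq h2
  have hne : p.im ^ 2 - q.im ^ 2 ≠ 0 := by
    intro h
    refine hpq (UpperHalfPlane.ext_re_im (hp.trans hq.symm) ?_)
    exact (pow_left_inj₀ p.im_pos.le q.im_pos.le two_ne_zero).1 (sub_eq_zero.1 h)
  have him : w.im = z.im := by
    have : (p.im ^ 2 - q.im ^ 2) * (w.im - z.im) = 0 := by linear_combination k1 - k2
    linarith [(mul_eq_zero.1 this).resolve_left hne]
  have hsq : w.re ^ 2 = z.re ^ 2 := by
    rw [him] at k1
    have := mul_right_cancel₀ z.im_pos.ne' k1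
    rw [normSq_coe, normSq_coe, him] at this
    linarith
  rcases sq_eq_sq_iff_eq_or_eq_neg.1 hsq with h | h
  · exact Or.inl (UpperHalfPlane.ext_re_im h him)
  · refine Or.inr (UpperHalfPlane.ext_re_im ?_ ?_)
    · rw [h, ← UpperHalfPlane.coe_re, ← UpperHalfPlane.coe_re, UpperHalfPlane.coe_J_smul]; simp
    · rw [him, ← UpperHalfPlane.coe_im, ← UpperHalfPlane.coe_im, UpperHalfPlane.coe_J_smul]; simp

/-- Two triangles with a common side and congruent remaining sides are equal or mirror images. -/
lemma eq_or_signedArea_eq_neg (o : ℤˣ) {p q z w : ℍ}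
    (h1 : dist p z = dist p w) (h2 : dist q z = dist q w) :
    w = z ∨ signedArea o p q w = -signedArea o p q z := by
  rcases eq_or_ne p q with rfl | hpq
  · right; simp [signedArea_self_left]
  obtain ⟨g, hp, hq⟩ := exists_smul_re_eq_zero p q
  have hfix : ∀ v : ℍ, v.re = 0 → UpperHalfPlane.J • v = v := by
    intro v hv
    refine UpperHalfPlane.ext_re_im ?_ ?_
    · rw [← UpperHalfPlane.coe_re, UpperHalfPlane.coe_J_smul]; simp [hv]
    · rw [← UpperHalfPlane.coe_im, UpperHalfPlane.coe_J_smul]; simp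
  rcases eq_or_eq_J_smul hp hq (fun h => hpq (smul_left_cancel g h))
    ((dist_smul_GL g p z).trans (h1.trans (dist_smul_GL g p w).symm))
    ((dist_smul_GL g q z).trans (h2.trans (dist_smul_GL g q w).symm)) with h | h
  · exact Or.inl (smul_left_cancel g h)
  · right
    have hs : ((SignType.sign g.det.val : SignType) : ℝ) ≠ 0 := by
      rcases (Units.ne_zero g.det).lt_or_gt with h | h
      · rw [sign_neg h]; simp
      · rw [sign_pos h]; simp
    refine mul_left_cancel₀ hs ?_
    rw [← signedArea_smul_GL, h]
    nth_rewrite 1 [← hfix _ hp, ← hfix _ hq]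
    rw [signedArea_smul_GL, UpperHalfPlane.det_J, signedArea_smul_GL]
    simp

/-! ### The area cocycle and the volume -/

lemma areaCochain_apply (o : ℤˣ) (z : ℍ) (A B : PSL(2, ℝ)) :
    areaCochain o z (A, B) = signedArea o z (A • z) ((A * B) • z) := rfl

lemma areaCochain_mem (o : ℤˣ) (z : ℍ) : areaCochain o z ∈ boundedCocycles PSL(2, ℝ) := by
  refine ⟨⟨3 * Real.pi, fun x => abs_signedArea_le _ _ _ _⟩, ?_⟩
  ext ⟨A, B, C⟩
  have h1 := signedArea_cocycle o z (A • z) ((A * B) • z) ((A * B * C) • z)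
  have h2 := signedArea_smul o A z (B • z) ((B * C) • z)
  simp only [smul_smul, ← mul_assoc] at h2
  simp only [delta₂, LinearMap.coe_mk, AddHom.coe_mk, Pi.zero_apply, areaCochain_apply,
    ← mul_assoc]
  linarith

/-- The class of the area cocycle does not depend on the base point: the area of the two triangles
into which the quadrilateral `z, w, A w, A z` is cut gives a bounded primitive of the difference. -/
lemma boundedClass_areaCochain (o : ℤˣ) (z w : ℍ) :
    boundedClass (areaCochain o z) = boundedClass (areaCochain o w) := by
  rw [boundedClass, boundedClass, dif_pos (areaCochain_mem o z), dif_pos (areaCochain_mem o w),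
    eq_comm, Submodule.Quotient.eq]
  refine ⟨fun A => signedArea o z w (A • w) - signedArea o z (A • z) (A • w),
    ⟨3 * Real.pi + 3 * Real.pi, fun A => (abs_sub _ _).trans
      (add_le_add (abs_signedArea_le _ _ _ _) (abs_signedArea_le _ _ _ _))⟩, ?_⟩
  ext ⟨A, B⟩
  have h1 := signedArea_cocycle o z w (A • w) ((A * B) • w)
  have h2 := signedArea_cocycle o z (A • z) (A • w) ((A * B) • w)
  have h3 := signedArea_cocycle o z (A • z) ((A * B) • z) ((A * B) • w)
  have h4 := signedArea_smul o A z w (B • w)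
  have h5 := signedArea_smul o A z (B • z) (B • w)
  simp only [smul_smul] at h4 h5
  simp only [delta₁, LinearMap.coe_mk, AddHom.coe_mk, Submodule.subtype_apply,
    AddSubgroupClass.coe_sub, Pi.sub_apply, areaCochain_apply]
  linarith

lemma vol_base_point (o : ℤˣ) (z w : ℍ) (φ : PiOne →* PSL(2, ℝ)) : vol o z φ = vol o w φ := by
  rw [vol, vol, boundedClass_areaCochain o z w]

/-- The volume is computed by the relative cocycle whose peripheral parts are
`g ↦ [Δ(Cᵢ, z, φ(g) z)]`, where `Cᵢ` is fixed by the peripheral subgroup. -/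
lemma vol_eq (o : ℤˣ) (z : ℍ) (φ : PiOne →* PSL(2, ℝ)) {C : Fin 3 → ℍ}
    (hC : ∀ i, φ (gen i) • C i = C i) :
    vol o z φ = signedArea o z (φ (gen 0) • z) (φ (gen 0 * gen 1) • z)
      - ∑ i, signedArea o (C i) z (φ (gen i) • z) := by
  have hfix : ∀ (i : Fin 3), ∀ g ∈ peripheral i, φ g • C i = C i := by
    rintro i g hg
    obtain ⟨n, rfl⟩ := Subgroup.mem_zpowers_iff.1 hg
    rw [map_zpow]
    exact zpow_mem (K := MulAction.stabilizer PSL(2, ℝ) (C i)) (hC i) n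
  have hf := areaCochain_mem o z
  have hmem : (pullbackCochain φ (areaCochain o z),
      fun i (g : peripheral i) => signedArea o (C i) z (φ g • z))
      ∈ relBoundedCocycles PiOne peripheral := by
    refine ⟨pullbackCochain_mem φ _ hf, fun i => ⟨⟨3 * Real.pi, fun _ =>
      abs_signedArea_le _ _ _ _⟩, ?_⟩⟩
    ext ⟨a, b⟩
    have h1 := signedArea_cocycle o (C i) z (φ a • z) (φ (a * b) • z)
    have h2 := signedArea_smul o (φ a) (C i) z (φ b • z)
    rw [hfix i a a.2, smul_smul, ← map_mul] at h2
    simp only [delta₁, restr₂, pullbackCochain, LinearMap.funLeft_apply, Prod.map_apply,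
      LinearMap.coe_mk, AddHom.coe_mk, areaCochain_apply, ← map_mul, Subgroup.coe_mul]
    linarith
  have hj : (jEquiv PiOne peripheral).symm
      (BoundedH2.pullback φ (boundedClass (areaCochain o z)))
      = Submodule.Quotient.mk ⟨_, hmem⟩ := by
    rw [LinearEquiv.symm_apply_eq, boundedClass, dif_pos hf]
    rfl
  rw [vol, hj]
  change evalChain fundamentalCycle.1 _ = _
  simp [evalChain, fundamentalCycle, pullbackCochain, LinearMap.funLeft_apply, areaCochain_apply,
    ← map_mul, gen_mul, signedArea_self_outer]

end PuncturedSphere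

end

theorem lemma3p3 (o : ℤˣ) (φ : PuncturedSphere.PiOne →* PSL(2, ℝ))
    (hφ : ∀ i, PuncturedSphere.IsElliptic (φ (PuncturedSphere.gen i))) (z : ℍ) :
    PuncturedSphere.areaCochain o z ∈ PuncturedSphere.boundedCocycles PSL(2, ℝ) ∧
      PuncturedSphere.vol o z φ =
        -2 * PuncturedSphere.signedArea o (hφ 0).fix (hφ 1).fix (hφ 2).fix := by
  open PuncturedSphere in
  refine ⟨areaCochain_mem o z, ?_⟩
  have hC : ∀ i, φ (gen i) • (hφ i).fix = (hφ i).fix := fun i => (hφ i).smul_fix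
  have huniq : ∀ i, ∀ w : ℍ, φ (gen i) • w = w → (hφ i).fix = w := fun i w hw =>
    (hφ i).unique (hC i) hw
  rw [vol_base_point o z (hφ 1).fix, vol_eq o _ φ hC, Fin.sum_univ_three]
  simp only [map_mul, mul_smul, hC 1, signedArea_self_right]
  set D := φ (gen 0) • (hφ 1).fix with hD
  have hD2 : φ (gen 2) • D = (hφ 1).fix := by
    have h : gen 2 * (gen 0 * gen 1) = 1 := by rw [mul_eq_one_comm, gen_mul]
    have h' := congrArg (fun g => φ g • (hφ 1).fix) h
    simpa only [map_mul, mul_smul, hC 1, map_one, one_smul] using h'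
  -- `D` and the second fixed point have the same distances to the two other fixed points
  have h0 : dist (hφ 0).fix (hφ 1).fix = dist (hφ 0).fix D := by
    rw [← dist_smul_PSL (φ (gen 0)) (hφ 0).fix (hφ 1).fix, hC 0]
  have h2 : dist (hφ 2).fix (hφ 1).fix = dist (hφ 2).fix D := by
    rw [← dist_smul_PSL (φ (gen 2)) (hφ 2).fix D, hC 2, hD2]
  have hS := signedArea_smul o (φ (gen 2)) (hφ 2).fix D (hφ 1).fix
  rw [hC 2, hD2] at hS
  rw [hS]
  rcases eq_or_signedArea_eq_neg o h0 h2 with h | h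
  · rw [huniq 0 _ h, huniq 2 (hφ 1).fix (by nth_rewrite 1 [← h]; exact hD2), h]
    simp only [signedArea_self_left]
    ring
  · have hcoc := signedArea_cocycle o (hφ 0).fix (hφ 1).fix (hφ 2).fix D
    have e1 := signedArea_swap o (hφ 0).fix (hφ 1).fix (hφ 2).fix
    have e2 := signedArea_rotate o (hφ 1).fix (hφ 2).fix D
    linarith
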